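/- For integers $1\le n\le N$ and $\rho\in(0,1]$, consider the following two distributions of a random matrix $\tilde Y\in\mathbb R^{N\times n}$. - Null distribution $\mathcal Q$: the entries of $\tilde Y$ are i.i.d. $\mathcal N(0,\frac1N)$. - Planted distribution $\mathcal P$: $\tilde Y=YQ$, where the first column of $Y\in\mathbb R^{N\times n}$ is a vector $v$ with i.i.d. entries equal to $0$ with probability $1-\rho$ and to each of $\pm\frac{1}{\sqrt{N\rho}}$ with probability $\rho/2$, the other $n-1$ columns of $Y$ are i.i.d. $\mathcal N(0,\frac1N I_N)$ vectors, $Q\in\mathbb R^{n\times n}$ is a uniformly random (Haar distributed) orthogonal matrix, and $v$, the Gaussian columns and $Q$ are independent. Let $\tilde y_i^\top$ denote the $i$-th row of $\tilde Y$, and let $$\tilde M=\sum_{i=1}^N\Big(\|\tilde y_i\|^2-\frac{n-1}{N}\Big)\tilde y_i\tilde y_i^\top-\frac3N I_n ,$$ where $\|\cdot\|$ is the Euclidean norm of vectors and the spectral norm of matrices. **Theorem.** Fix a constant $c_1\in(0,0.1)$. There exist constants $C_2,c_3>0$ depending only on $c_1$ such that the following holds for all integers $1\le n\le N$, all $\rho\in(0,1]$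 and all $\delta\in(0,\frac12)$. Suppose that $\rho\ge\frac{C_2\log(1/\delta)}{N}$, $|\rho-\frac13|\ge c_1$, $N\ge\log^7(N/\delta)$, and $$\Big(\frac{n\rho}{\sqrt N}+\sqrt{\frac nN}\Big)\log\frac N\delta\le c_3 .$$ Then $$\mathbb P_{\mathcal P}\Big\{\|\tilde M\|<\frac{c_1}{4N\rho}\Big\}+\mathbb P_{\mathcal Q}\Big\{\|\tilde M\|>\frac{c_1}{8N\rho}\Big\}\le\delta .$$ -/

import Mathlib

open MeasureTheory ProbabilityTheory

namespace PlantedVector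

noncomputable section

/-- Real matrices carry the product σ-algebra of their entries. -/
instance matrixMeasurableSpace (m n : ℕ) : MeasurableSpace (Matrix (Fin m) (Fin n) ℝ) :=
  (inferInstance : MeasurableSpace (Fin m → Fin n → ℝ))

instance matrixBorelSpace (m n : ℕ) : BorelSpace (Matrix (Fin m) (Fin n) ℝ) :=
  (inferInstance : BorelSpace (Fin m → Fin n → ℝ))

/-- The Bernoulli--Rademacher law of a single entry: the value `0` with probability `1 - ρ` and
each of the values `1 / √(N ρ)` and `-1 / √(N ρ)` with probability `ρ / 2`. -/
def brEntry (N : ℕ) (ρ : ℝ) : Measure ℝ :=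
  (1 - ρ).toNNReal • Measure.dirac (0 : ℝ)
    + (ρ / 2).toNNReal • Measure.dirac (1 / √(N * ρ))
    + (ρ / 2).toNNReal • Measure.dirac (-1 / √(N * ρ))

instance brEntry_isFiniteMeasure (N : ℕ) (ρ : ℝ) : IsFiniteMeasure (brEntry N ρ) := by
  unfold brEntry; infer_instance

theorem brEntry_isProbabilityMeasure (N : ℕ) {ρ : ℝ} (h0 : 0 < ρ) (h1 : ρ ≤ 1) :
    IsProbabilityMeasure (brEntry N ρ) := by
  refine ⟨?_⟩
  simp only [brEntry, Measure.add_apply, Measure.smul_apply, measure_univ,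
    ENNReal.smul_def, smul_eq_mul, mul_one]
  norm_cast
  rw [← Real.toNNReal_add (by linarith) (by linarith),
    ← Real.toNNReal_add (by linarith) (by linarith),
    show 1 - ρ + ρ / 2 + ρ / 2 = 1 by ring, Real.toNNReal_one]

/-- The law `BR(N, ρ)` of a random vector in `ℝ^N` with i.i.d. Bernoulli--Rademacher entries. -/
def brVector (N : ℕ) (ρ : ℝ) : Measure (Fin N → ℝ) :=
  Measure.pi fun _ => brEntry N ρ

/-- The law of an `N × n` random matrix with i.i.d. `𝒩(0, 1/N)` entries. -/
def gaussianMatrix (N n : ℕ) : Measure (Matrix (Fin N) (Fin n) ℝ) :=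
  (Measure.pi fun _ => Measure.pi fun _ => gaussianReal 0 (N : NNReal)⁻¹ :
    Measure (Fin N → Fin n → ℝ))

instance gaussianMatrix_isProbabilityMeasure (N n : ℕ) :
    IsProbabilityMeasure (gaussianMatrix N n) :=
  (inferInstance : IsProbabilityMeasure
    (Measure.pi fun _ => Measure.pi fun _ => gaussianReal 0 (N : NNReal)⁻¹ :
      Measure (Fin N → Fin n → ℝ)))

/-- The orthogonal group `O(n)`, with the topology and the σ-algebra inherited from `n × n`
matrices, is compact. -/
instance orthogonalGroup_compactSpace (n : ℕ) :
    CompactSpace (Matrix.orthogonalGroup (Fin n) ℝ) := by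
  have hK : IsCompact (Set.pi Set.univ fun _ : Fin n => Set.pi Set.univ fun _ : Fin n =>
      Metric.closedBall (0 : ℝ) 1) :=
    isCompact_univ_pi fun _ => isCompact_univ_pi fun _ => isCompact_closedBall 0 1
  have h : IsCompact (Matrix.orthogonalGroup (Fin n) ℝ : Set (Matrix (Fin n) (Fin n) ℝ)) := by
    refine IsCompact.of_isClosed_subset (X := Matrix (Fin n) (Fin n) ℝ) hK isClosed_unitary ?_
    intro U hU i _ j _
    simpa using entry_norm_bound_of_unitary hU i j
  exact isCompact_iff_compactSpace.mp h

instance orthogonalGroup_measurableSpace (n : ℕ) :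
    MeasurableSpace (Matrix.orthogonalGroup (Fin n) ℝ) :=
  Subtype.instMeasurableSpace

instance orthogonalGroup_borelSpace (n : ℕ) :
    BorelSpace (Matrix.orthogonalGroup (Fin n) ℝ) :=
  Subtype.borelSpace _

/-- The law of a uniformly random orthogonal matrix: the Haar measure on the compact group `O(n)`
of total mass one. -/
def uniformOrthogonal (n : ℕ) : Measure (Matrix.orthogonalGroup (Fin n) ℝ) :=
  Measure.haarMeasure ⊤

instance uniformOrthogonal_isProbabilityMeasure (n : ℕ) :
    IsProbabilityMeasure (uniformOrthogonal n) :=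
  ⟨Measure.haarMeasure_self⟩

/-- The matrix whose first column is `v` and whose other columns are those of `G`. -/
def plantFirstColumn {N n : ℕ} (v : Fin N → ℝ) (G : Matrix (Fin N) (Fin n) ℝ) :
    Matrix (Fin N) (Fin n) ℝ :=
  Matrix.of fun i j => if (j : ℕ) = 0 then v i else G i j

/-- The observation `Y Q`, where `Y` has first column `v` and other columns those of `G`. -/
def plantedObservation {N n : ℕ}
    (ω : (Fin N → ℝ) × Matrix (Fin N) (Fin n) ℝ × Matrix.orthogonalGroup (Fin n) ℝ) :
    Matrix (Fin N) (Fin n) ℝ :=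
  plantFirstColumn ω.1 ω.2.1 * (ω.2.2 : Matrix (Fin n) (Fin n) ℝ)

theorem measurable_plantedObservation {N n : ℕ} :
    Measurable (plantedObservation (N := N) (n := n)) := by
  refine measurable_pi_iff.2 fun i => measurable_pi_iff.2 fun j => ?_
  simp only [plantedObservation, plantFirstColumn, Matrix.mul_apply, Matrix.of_apply]
  refine Finset.measurable_sum _ fun k _ => Measurable.mul ?_ ?_
  · split_ifs
    · exact (measurable_pi_apply i).comp measurable_fst
    · exact (measurable_pi_apply k).comp
        ((measurable_pi_apply i).comp (measurable_fst.comp measurable_snd))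
  · exact (measurable_pi_apply j).comp ((measurable_pi_apply k).comp
      (measurable_subtype_coe.comp (measurable_snd.comp measurable_snd)))

/-- The null distribution `𝒬`: i.i.d. `𝒩(0, 1/N)` entries. -/
def nullLaw (N n : ℕ) : Measure (Matrix (Fin N) (Fin n) ℝ) :=
  gaussianMatrix N n

/-- The planted distribution `𝒫`: the law of `Y Q`, where `v ∼ BR(N, ρ)`, the Gaussian columns of
`Y` and the uniformly random orthogonal matrix `Q` are independent and `v` is the first column of
`Y`. The first column of the Gaussian matrix that is drawn here is discarded. -/
def plantedLaw (N n : ℕ) (ρ : ℝ) : Measure (Matrix (Fin N) (Fin n) ℝ) :=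
  ((brVector N ρ).prod ((gaussianMatrix N n).prod (uniformOrthogonal n))).map plantedObservation

instance nullLaw_isProbabilityMeasure (N n : ℕ) : IsProbabilityMeasure (nullLaw N n) :=
  gaussianMatrix_isProbabilityMeasure N n

theorem plantedLaw_isProbabilityMeasure (N n : ℕ) {ρ : ℝ} (h0 : 0 < ρ) (h1 : ρ ≤ 1) :
    IsProbabilityMeasure (plantedLaw N n ρ) := by
  have := brEntry_isProbabilityMeasure N h0 h1
  have : IsProbabilityMeasure (brVector N ρ) := by unfold brVector; infer_instance
  exact Measure.isProbabilityMeasure_map measurable_plantedObservation.aemeasurable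

/-- The matrix `M̃ = ∑ᵢ (‖yᵢ‖² - (n - 1) / N) yᵢ yᵢᵀ - (3 / N) Iₙ`, where `yᵢᵀ` is the `i`-th row
of `Y`. -/
def spectralMatrix {N n : ℕ} (Y : Matrix (Fin N) (Fin n) ℝ) : Matrix (Fin n) (Fin n) ℝ :=
  (∑ i, ((∑ j, Y i j ^ 2) - ((n : ℝ) - 1) / N) • Matrix.vecMulVec (Y i) (Y i))
    - (3 / (N : ℝ)) • (1 : Matrix (Fin n) (Fin n) ℝ)

/-- The spectral norm of a square matrix: its operator norm on Euclidean space. -/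
def specNorm {n : ℕ} (M : Matrix (Fin n) (Fin n) ℝ) : ℝ :=
  ‖Matrix.toEuclideanCLM (n := Fin n) (𝕜 := ℝ) M‖

end

end PlantedVector

namespace PlantedVector

/-! Both error probabilities are bounded through the quadratic form of the spectral matrix: over a
net of directions under the null law, and at the single planted direction under the planted law.

Null law. For a unit vector `u` and standard Gaussian rows `x_i`, the form equals `N⁻² (∑ (‖x_i‖² -
(n-1)) ⟨u, x_i⟩² - 3N)`. Each summand has mean `(n+2) - (n-1) = 3`, so the subtracted identity
centres it. A summand has degree four and no exponential moments, so `‖x_i‖² - (n-1)` is truncated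
at a level `B` of order `√n log (N/δ)`. This exceeds its typical size `√n` by a logarithm, so
truncation rarely acts and changes the mean very little. The truncated summand is at most `B (⟨u,
x_i⟩² + 1)` in absolute value, and Chernoff's bound applies
(`measureReal_abs_sum_truncTerm_sub_ge_le`). With deviation `s` of order `N/ρ` and exponent `t = 2n
+ log (N/δ)`, enough for a union bound over `5 ^ n` net points, the main variance requirement `N B²
t ≲ s²` becomes `n ρ log (N/δ) ≲ √N`, which is the scaling hypothesis. `norm_le_of_net` passes from
the net to the norm.

Planted law. At the row `u` of `Q` that corresponds to the planted column, `Ỹ u = v`, and `Q`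
preserves row norms. So the form is `(Nρ)⁻¹ (S/(Nρ) - 3ρ + noise/N)`, where `S` counts the support
of `v` (`specNorm_plantedObservation_ge`). `S` concentrates at `Nρ`, and the noise, conditionally on
`v`, is a weighted sum of centred squared Gaussians. What remains is about `|1 - 3ρ|/(Nρ)`, bounded
below since `ρ` stays away from `1/3`. -/

/-! ### Exponential moments and Chernoff bounds -/

theorem exp_le_one_add_add_sq_mul_exp_abs (x : ℝ) :
    Real.exp x ≤ 1 + x + x ^ 2 * Real.exp |x| := by
  have h := Complex.norm_exp_sub_sum_le_norm_mul_exp (x : ℂ) 2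
  simp only [Finset.sum_range_succ, Finset.sum_range_zero, pow_zero, pow_one, Nat.factorial] at h
  have e : Complex.exp x - (0 + 1 / ((1 : ℕ) : ℂ) + (x : ℂ) / (((0 + 1) * 1 : ℕ) : ℂ))
      = ((Real.exp x - (1 + x) : ℝ) : ℂ) := by
    push_cast; ring
  rw [e, Complex.norm_real, Complex.norm_real, Real.norm_eq_abs, Real.norm_eq_abs, sq_abs] at h
  linarith [le_abs_self (Real.exp x - (1 + x))]

theorem measureReal_le_exp_of_integral_exp_le {Ω : Type*} [MeasurableSpace Ω] {μ : Measure Ω}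
    {f : Ω → ℝ} {a s : ℝ}
    (hf : Integrable (fun ω => Real.exp (f ω)) μ) (h : ∫ ω, Real.exp (f ω) ∂μ ≤ Real.exp a) :
    μ.real {ω | s ≤ f ω} ≤ Real.exp (a - s) := by
  have h1 := mul_meas_ge_le_integral_of_nonneg (μ := μ)
    (Filter.Eventually.of_forall fun ω => (Real.exp_pos (f ω)).le) hf (Real.exp s)
  simp only [Real.exp_le_exp] at h1
  rw [Real.exp_sub, le_div_iff₀ (Real.exp_pos _), mul_comm]
  exact h1.trans h

section Generic

variable {Ω : Type*} [MeasurableSpace Ω] {μ : Measure Ω} [IsProbabilityMeasure μ]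

/-- A Bernstein type bound: if `|X| ≤ t Y` with `t ≤ 1/4`, then `𝔼 e^X ≤ e^{𝔼 X + O(t²)}`. -/
theorem integral_exp_le_of_abs_le {X Y : Ω → ℝ} {t : ℝ} (hX : Measurable X) (ht0 : 0 ≤ t)
    (ht : t ≤ 1 / 4) (hXY : ∀ ω, |X ω| ≤ t * Y ω)
    (hY : Integrable (fun ω => Y ω ^ 2 * Real.exp (Y ω / 4)) μ) (hY0 : ∀ ω, 0 ≤ Y ω) :
    Integrable (fun ω => Real.exp (X ω)) μ ∧ Integrable X μ ∧
      ∫ ω, Real.exp (X ω) ∂μ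
        ≤ Real.exp (∫ ω, X ω ∂μ + t ^ 2 * ∫ ω, Y ω ^ 2 * Real.exp (Y ω / 4) ∂μ) := by
  have hsq : ∀ ω, X ω ^ 2 * Real.exp |X ω| ≤ t ^ 2 * (Y ω ^ 2 * Real.exp (Y ω / 4)) := by
    intro ω
    have h1 : X ω ^ 2 ≤ (t * Y ω) ^ 2 := by
      rw [← sq_abs (X ω)]; exact pow_le_pow_left₀ (abs_nonneg _) (hXY ω) 2
    have h2 : |X ω| ≤ Y ω / 4 := (hXY ω).trans (by nlinarith [hY0 ω])
    calc X ω ^ 2 * Real.exp |X ω| ≤ (t * Y ω) ^ 2 * Real.exp (Y ω / 4) :=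
          mul_le_mul h1 (Real.exp_le_exp.2 h2) (Real.exp_pos _).le (sq_nonneg _)
      _ = _ := by ring
  have hXi : Integrable X μ := by
    refine ((integrable_const (1 : ℝ)).add hY).mono' hX.aestronglyMeasurable
      (Filter.Eventually.of_forall fun ω => ?_)
    rw [Real.norm_eq_abs]
    have h1 : 1 ≤ Real.exp (Y ω / 4) := Real.one_le_exp (by linarith [hY0 ω])
    have h2 := hXY ω
    have h3 := hY0 ω
    simp only [Pi.add_apply]
    nlinarith [mul_le_mul_of_nonneg_left h1 (sq_nonneg (Y ω)), sq_nonneg (Y ω - 1)]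
  have hle : ∀ ω, Real.exp (X ω) ≤ 1 + X ω + t ^ 2 * (Y ω ^ 2 * Real.exp (Y ω / 4)) := fun ω =>
    (exp_le_one_add_add_sq_mul_exp_abs _).trans (by linarith [hsq ω])
  have hI : Integrable (fun ω => 1 + X ω + t ^ 2 * (Y ω ^ 2 * Real.exp (Y ω / 4))) μ :=
    ((integrable_const 1).add hXi).add (hY.const_mul _)
  have hE : Integrable (fun ω => Real.exp (X ω)) μ := by
    refine hI.mono' (Real.measurable_exp.comp hX).aestronglyMeasurable
      (Filter.Eventually.of_forall fun ω => ?_)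
    rw [Real.norm_eq_abs, abs_of_pos (Real.exp_pos _)]
    exact hle ω
  refine ⟨hE, hXi, (integral_mono hE hI hle).trans ?_⟩
  rw [integral_add (f := fun ω => 1 + X ω) ((integrable_const 1).add hXi) (hY.const_mul _),
    integral_add (integrable_const 1) hXi, integral_const_mul]
  simp only [integral_const, probReal_univ, smul_eq_mul, mul_one]
  have := Real.add_one_le_exp (∫ ω, X ω ∂μ + t ^ 2 * ∫ ω, Y ω ^ 2 * Real.exp (Y ω / 4) ∂μ)
  linarith

end Generic

section Pi

variable {ι : Type*} [Fintype ι] {E : ι → Type*} [∀ i, MeasurableSpace (E i)]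
  {μ : ∀ i, Measure (E i)} [∀ i, IsProbabilityMeasure (μ i)]

theorem integral_exp_sum_pi_le {f : ∀ i, E i → ℝ} {a : ι → ℝ}
    (hf : ∀ i, Integrable (fun x => Real.exp (f i x)) (μ i))
    (h : ∀ i, ∫ x, Real.exp (f i x) ∂μ i ≤ Real.exp (a i)) :
    Integrable (fun x : ∀ i, E i => Real.exp (∑ i, f i (x i))) (Measure.pi μ) ∧
      ∫ x, Real.exp (∑ i, f i (x i)) ∂Measure.pi μ ≤ Real.exp (∑ i, a i) := by
  simp only [Real.exp_sum]
  refine ⟨Integrable.fintype_prod_dep (f := fun i x => Real.exp (f i x)) hf, ?_⟩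
  rw [integral_fintype_prod_eq_prod (fun i x => Real.exp (f i x))]
  exact Finset.prod_le_prod (fun i _ => integral_nonneg fun x => (Real.exp_pos _).le)
    fun i _ => h i

/-- Chernoff's bound for a sum of independent random variables. -/
theorem measureReal_pi_sum_ge_le {f : ∀ i, E i → ℝ} {a : ι → ℝ} {s : ℝ}
    (hf : ∀ i, Integrable (fun x => Real.exp (f i x)) (μ i))
    (h : ∀ i, ∫ x, Real.exp (f i x) ∂μ i ≤ Real.exp (a i)) :
    (Measure.pi μ).real {x | s ≤ ∑ i, f i (x i)} ≤ Real.exp (∑ i, a i - s) := by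
  obtain ⟨h1, h2⟩ := integral_exp_sum_pi_le hf h
  exact measureReal_le_exp_of_integral_exp_le h1 h2

end Pi

/-! ### Moments of Gaussian vectors and of their linear forms -/

section Gaussian

theorem integrable_exp_mul_sq_gaussianReal {a : ℝ} (ha : a < 1 / 2) :
    Integrable (fun x => Real.exp (a * x ^ 2)) (gaussianReal 0 1) := by
  rw [gaussianReal_of_var_ne_zero 0 one_ne_zero,
    integrable_withDensity_iff_integrable_smul' (measurable_gaussianPDF 0 1)
      (Filter.Eventually.of_forall fun _ => gaussianPDF_lt_top)]
  have := (integrable_exp_neg_mul_sq (b := 1 / 2 - a) (by linarith)).const_mul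
    ((√(2 * Real.pi * (1 : NNReal)))⁻¹)
  refine this.congr (Filter.Eventually.of_forall fun x => ?_)
  simp only [toReal_gaussianPDF, gaussianPDFReal, smul_eq_mul, mul_assoc, ← Real.exp_add]
  congr 2
  push_cast
  ring

theorem integrable_sq_add_one_sq_mul_exp_gaussianReal :
    Integrable (fun x : ℝ => (x ^ 2 + 1) ^ 2 * Real.exp ((x ^ 2 + 1) / 4)) (gaussianReal 0 1) := by
  refine ((integrable_exp_mul_sq_gaussianReal (a := 3 / 8) (by norm_num)).const_mul
    (128 * Real.exp (3 / 8))).mono' (by fun_prop) (Filter.Eventually.of_forall fun x => ?_)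
  rw [Real.norm_eq_abs, abs_of_nonneg (by positivity)]
  have h := Real.quadratic_le_exp_of_nonneg (x := (x ^ 2 + 1) / 8) (by positivity)
  have h2 : (x ^ 2 + 1) ^ 2 ≤ 128 * Real.exp ((x ^ 2 + 1) / 8) := by nlinarith [sq_nonneg x]
  calc (x ^ 2 + 1) ^ 2 * Real.exp ((x ^ 2 + 1) / 4)
      ≤ 128 * Real.exp ((x ^ 2 + 1) / 8) * Real.exp ((x ^ 2 + 1) / 4) := by gcongr
    _ = 128 * Real.exp (3 / 8) * Real.exp (3 / 8 * x ^ 2) := by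
        rw [mul_assoc, mul_assoc, ← Real.exp_add, ← Real.exp_add]; congr 2; ring

/-- An absolute constant controlling exponential moments of the square of a Gaussian. -/
noncomputable def gaussianSqConst : ℝ :=
  ∫ x : ℝ, (x ^ 2 + 1) ^ 2 * Real.exp ((x ^ 2 + 1) / 4) ∂gaussianReal 0 1

theorem gaussianSqConst_nonneg : 0 ≤ gaussianSqConst :=
  integral_nonneg fun x => by positivity

theorem integral_pow_two_gaussianReal : ∫ x, x ^ 2 ∂gaussianReal 0 1 = 1 := by
  have h := variance_fun_id_gaussianReal (μ := 0) (v := 1)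
  rw [variance_eq_integral (by fun_prop)] at h
  simpa [integral_id_gaussianReal] using h

/-- The moment is the fourth derivative at `0` of the moment generating function `e^{t²/2}`.
Differentiating `p e^{t²/2}` replaces `p` by `p' + t p`, which gives the polynomials `1, t, 1 + t²,
3t + t³, 3 + 6t² + t⁴`. -/
theorem integral_pow_four_gaussianReal : ∫ x, x ^ 4 ∂gaussianReal 0 1 = 3 := by
  have h := iteratedDeriv_mgf_zero (X := fun x : ℝ => x) (μ := gaussianReal 0 1) (by simp) 4
  have d : ∀ (p q : ℝ → ℝ), (∀ t, HasDerivAt p (q t - t * p t) t) →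
      deriv (fun t => p t * Real.exp (t ^ 2 / 2)) = fun t => q t * Real.exp (t ^ 2 / 2) := by
    intro p q hp
    ext t
    have he : HasDerivAt (fun t : ℝ => Real.exp (t ^ 2 / 2)) (Real.exp (t ^ 2 / 2) * t) t := by
      have := ((hasDerivAt_pow 2 t).div_const 2).exp
      convert this using 1
      norm_num
    refine (((hp t).fun_mul he).congr_deriv ?_).deriv
    ring
  have h0 : mgf (fun x : ℝ => x) (gaussianReal 0 1)
      = fun t => (1 : ℝ) * Real.exp (t ^ 2 / 2) := by
    rw [mgf_fun_id_gaussianReal]; ext t; simp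
  rw [h0] at h
  simp only [iteratedDeriv_succ, iteratedDeriv_zero] at h
  rw [d (fun _ => 1) (fun t => t) (fun t => by simpa using hasDerivAt_const t (1 : ℝ)),
    d (fun t => t) (fun t => 1 + t ^ 2) (fun t => (hasDerivAt_id' t).congr_deriv (by ring)),
    d (fun t => 1 + t ^ 2) (fun t => 3 * t + t ^ 3) (fun t =>
      ((hasDerivAt_pow 2 t).const_add 1).congr_deriv (by norm_num; ring)),
    d (fun t => 3 * t + t ^ 3) (fun t => 3 + 6 * t ^ 2 + t ^ 4) (fun t =>
      (((hasDerivAt_id' t).const_mul 3).fun_add (hasDerivAt_pow 3 t)).congr_deriv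
        (by norm_num; ring))] at h
  simpa using h.symm

/-- The standard Gaussian measure on `ℝ^n`. -/
noncomputable abbrev stdGauss (n : ℕ) : Measure (Fin n → ℝ) :=
  Measure.pi fun _ => gaussianReal 0 1

theorem measurable_linear {n : ℕ} (w : Fin n → ℝ) :
    Measurable fun x : Fin n → ℝ => ∑ j, w j * x j :=
  Finset.measurable_sum _ fun j _ => (measurable_pi_apply j).const_mul _

theorem map_linear_stdGauss {n : ℕ} (w : Fin n → ℝ) :
    (stdGauss n).map (fun x => ∑ j, w j * x j) = gaussianReal 0 (∑ j, w j ^ 2).toNNReal := by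
  have : IsProbabilityMeasure ((stdGauss n).map (fun x => ∑ j, w j * x j)) :=
    Measure.isProbabilityMeasure_map (measurable_linear w).aemeasurable
  refine Measure.ext_of_charFun ?_
  ext t
  rw [charFun_gaussianReal, charFun_apply_real, integral_map (measurable_linear w).aemeasurable
    (by fun_prop)]
  have : ∀ x : Fin n → ℝ, Complex.exp (t * ((∑ j, w j * x j : ℝ) : ℂ) * Complex.I)
      = ∏ j, Complex.exp (((t * w j : ℝ) : ℂ) * (x j : ℂ) * Complex.I) := by
    intro x
    rw [← Complex.exp_sum]
    congr 1
    push_cast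
    rw [Finset.mul_sum, Finset.sum_mul]
    exact Finset.sum_congr rfl fun j _ => by ring
  simp_rw [this]
  rw [integral_fintype_prod_eq_prod
    (fun j (y : ℝ) => Complex.exp (((t * w j : ℝ) : ℂ) * (y : ℂ) * Complex.I))]
  simp_rw [← charFun_apply_real, charFun_gaussianReal]
  rw [← Complex.exp_sum]
  congr 1
  rw [Real.coe_toNNReal _ (Finset.sum_nonneg fun j _ => sq_nonneg _)]
  push_cast
  rw [Finset.sum_mul, Finset.sum_div]
  simp only [mul_zero, zero_mul, zero_sub, Finset.sum_neg_distrib]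
  congr 1
  exact Finset.sum_congr rfl fun j _ => by ring

end Gaussian

theorem integral_exp_sum_sq_sub_one_le {n : ℕ} {c : Fin n → ℝ} (hc : ∀ j, |c j| ≤ 1 / 4) :
    Integrable (fun x => Real.exp (∑ j, c j * (x j ^ 2 - 1))) (stdGauss n) ∧
      ∫ x, Real.exp (∑ j, c j * (x j ^ 2 - 1)) ∂stdGauss n
        ≤ Real.exp (∑ j, c j ^ 2 * gaussianSqConst) := by
  have key := fun j => integral_exp_le_of_abs_le (μ := gaussianReal 0 1)
    (X := fun x : ℝ => c j * (x ^ 2 - 1)) (Y := fun x => x ^ 2 + 1) (t := |c j|) (by fun_prop)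
    (abs_nonneg _) (hc j) (fun x => by
      rw [abs_mul]
      refine mul_le_mul_of_nonneg_left ?_ (abs_nonneg _)
      rw [abs_le]; constructor <;> nlinarith [sq_nonneg x])
    integrable_sq_add_one_sq_mul_exp_gaussianReal (fun x => by positivity)
  have hsq : Integrable (fun x : ℝ => x ^ 2) (gaussianReal 0 1) :=
    (memLp_id_gaussianReal 2).integrable_sq
  refine integral_exp_sum_pi_le (f := fun j x => c j * (x ^ 2 - 1)) (fun j => (key j).1)
    fun j => (key j).2.2.trans (le_of_eq ?_)
  rw [integral_const_mul, integral_sub hsq (integrable_const 1), integral_pow_two_gaussianReal,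
    sq_abs]
  simp [gaussianSqConst]

theorem map_mul_gaussianReal_sqrt {v : ℝ} (hv : 0 ≤ v) :
    (gaussianReal 0 1).map (fun x => √v * x) = gaussianReal 0 v.toNNReal := by
  rw [gaussianReal_map_const_mul]
  congr 1
  · simp
  · ext
    simp [Real.sq_sqrt hv, hv]

theorem integral_linear_pow_four {n : ℕ} (w : Fin n → ℝ) :
    Integrable (fun x => (∑ j, w j * x j) ^ 4) (stdGauss n) ∧
      ∫ x, (∑ j, w j * x j) ^ 4 ∂stdGauss n = 3 * (∑ j, w j ^ 2) ^ 2 := by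
  have hv : 0 ≤ ∑ j, w j ^ 2 := Finset.sum_nonneg fun j _ => sq_nonneg _
  have h4 : Integrable (fun x : ℝ => x ^ 4) (gaussianReal 0 1) := by
    have := (memLp_id_gaussianReal (μ := 0) (v := 1) 4).integrable_norm_pow (by norm_num)
    refine this.congr (Filter.Eventually.of_forall fun x => ?_)
    simp [Even.pow_abs (by decide : Even 4)]
  have hm := map_linear_stdGauss w
  rw [← map_mul_gaussianReal_sqrt hv] at hm
  have hsm : AEStronglyMeasurable (fun x : ℝ => x ^ 4)
      ((gaussianReal 0 1).map (fun x => √(∑ j, w j ^ 2) * x)) := by fun_prop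
  constructor
  · refine (integrable_map_measure (f := fun x : Fin n → ℝ => ∑ j, w j * x j)
      (g := fun x : ℝ => x ^ 4)
      (by fun_prop) (measurable_linear w).aemeasurable).1 ?_
    rw [hm, integrable_map_measure hsm (by fun_prop)]
    simp only [Function.comp_def, mul_pow]
    exact h4.const_mul _
  · rw [← integral_map (f := fun x : ℝ => x ^ 4) (measurable_linear w).aemeasurable (by fun_prop),
      hm, integral_map (by fun_prop) hsm]
    simp only [mul_pow]
    rw [integral_const_mul, integral_pow_four_gaussianReal]
    rw [show √(∑ j, w j ^ 2) ^ 4 = (√(∑ j, w j ^ 2) ^ 2) ^ 2 by ring, Real.sq_sqrt hv]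
    ring

theorem measurePreserving_linear {n : ℕ} {u : Fin n → ℝ} (hu : ∑ j, u j ^ 2 = 1) :
    MeasurePreserving (fun x => ∑ j, u j * x j) (stdGauss n) (gaussianReal 0 1) := by
  refine ⟨measurable_linear u, ?_⟩
  rw [map_linear_stdGauss, hu]
  simp

theorem integral_linear_sq {n : ℕ} {u : Fin n → ℝ} (hu : ∑ j, u j ^ 2 = 1) :
    Integrable (fun x => (∑ j, u j * x j) ^ 2) (stdGauss n) ∧
      ∫ x, (∑ j, u j * x j) ^ 2 ∂stdGauss n = 1 := by
  have hm := measurePreserving_linear hu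
  constructor
  · exact hm.integrable_comp_of_integrable (g := fun x : ℝ => x ^ 2)
      (memLp_id_gaussianReal 2).integrable_sq
  · rw [← integral_map (f := fun x : ℝ => x ^ 2) (measurable_linear u).aemeasurable (by fun_prop),
      hm.map_eq, integral_pow_two_gaussianReal]

/-- Polarization: `12 a² b² = (a + b)⁴ + (a - b)⁴ - 2 (a⁴ + b⁴)`, so the mixed moment reduces to
fourth moments of linear forms. -/
theorem integral_coord_sq_mul_linear_sq {n : ℕ} {u : Fin n → ℝ} (hu : ∑ j, u j ^ 2 = 1)
    (k : Fin n) :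
    Integrable (fun x => x k ^ 2 * (∑ j, u j * x j) ^ 2) (stdGauss n) ∧
      ∫ x, x k ^ 2 * (∑ j, u j * x j) ^ 2 ∂stdGauss n = 1 + 2 * u k ^ 2 := by
  have hp := integral_linear_pow_four (fun j => Pi.single (M := fun _ => ℝ) k 1 j + u j)
  have hm := integral_linear_pow_four (fun j => Pi.single (M := fun _ => ℝ) k 1 j - u j)
  have h1 := integral_linear_pow_four (fun j => Pi.single (M := fun _ => ℝ) k 1 j)
  have h2 := integral_linear_pow_four u
  have e : ∀ x : Fin n → ℝ, ∑ j, Pi.single (M := fun _ => ℝ) k 1 j * x j = x k := by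
    intro x; simp [Pi.single_apply]
  have es : ∑ j, Pi.single (M := fun _ => ℝ) k 1 j ^ 2 = (1 : ℝ) := by
    simp [Pi.single_apply]
  have ep : ∑ j, (Pi.single (M := fun _ => ℝ) k 1 j + u j) ^ 2 = 2 + 2 * u k := by
    simp_rw [add_sq, mul_assoc]
    rw [Finset.sum_add_distrib, Finset.sum_add_distrib, es, hu, ← Finset.mul_sum, e]
    ring
  have em : ∑ j, (Pi.single (M := fun _ => ℝ) k 1 j - u j) ^ 2 = 2 - 2 * u k := by
    simp_rw [sub_sq, mul_assoc]
    rw [Finset.sum_add_distrib, Finset.sum_sub_distrib, es, hu, ← Finset.mul_sum, e]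
    ring
  simp only [add_mul, sub_mul, Finset.sum_add_distrib, Finset.sum_sub_distrib, e, ep, em, es, hu]
    at hp hm h1 h2
  have eq : ∀ x : Fin n → ℝ, x k ^ 2 * (∑ j, u j * x j) ^ 2
      = 1 / 12 * ((x k + ∑ j, u j * x j) ^ 4 + (x k - ∑ j, u j * x j) ^ 4)
        - 1 / 6 * (x k ^ 4 + (∑ j, u j * x j) ^ 4) := by
    intro x; ring
  simp_rw [eq]
  refine ⟨((hp.1.add hm.1).const_mul _).sub ((h1.1.add h2.1).const_mul _), ?_⟩
  have i1 := (hp.1.add hm.1).const_mul (1 / 12)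
  have i2 := (h1.1.add h2.1).const_mul (1 / 6)
  simp only [Pi.add_apply] at i1 i2
  rw [integral_sub i1 i2, integral_const_mul, integral_const_mul, integral_add hp.1 hm.1,
    integral_add h1.1 h2.1, hp.2, hm.2, h1.2, h2.2]
  ring

/-! ### Truncated row contributions: exponential moments and bias -/

/-- The centred squared norm of a row. -/
noncomputable def sqDev {n : ℕ} (x : Fin n → ℝ) : ℝ := (∑ j, x j ^ 2) - ((n : ℝ) - 1)

theorem measurable_sqDev {n : ℕ} : Measurable (sqDev (n := n)) :=
  (Finset.measurable_sum _ fun j _ => (measurable_pi_apply j).pow_const 2).sub_const _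

/-- Summing `1 + 2 u_k²` over `k` gives `n + 2`, and the centring removes `n - 1`. This is the
source of the `3` in the spectral matrix. -/
theorem integral_sqDev_mul_linear_sq {n : ℕ} {u : Fin n → ℝ} (hu : ∑ j, u j ^ 2 = 1) :
    Integrable (fun x => sqDev x * (∑ j, u j * x j) ^ 2) (stdGauss n) ∧
      ∫ x, sqDev x * (∑ j, u j * x j) ^ 2 ∂stdGauss n = 3 := by
  have h := fun k => integral_coord_sq_mul_linear_sq hu k
  have h2 := integral_linear_sq hu
  simp_rw [sqDev, sub_mul ( ∑ j, _ ), Finset.sum_mul _ _ ((∑ j, u j * _ ) ^ 2)]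
  have i1 := integrable_finsetSum Finset.univ fun k _ => (h k).1
  refine ⟨i1.sub (h2.1.const_mul _), ?_⟩
  rw [integral_sub i1 (h2.1.const_mul _), integral_const_mul, h2.2,
    integral_finsetSum _ fun k _ => (h k).1]
  simp_rw [(h _).2]
  rw [Finset.sum_add_distrib, ← Finset.mul_sum, hu]
  simp
  ring

/-- A bound for the exponential moment of `|sqDev|` at scale `√n`. -/
noncomputable def expMomentConst : ℝ := Real.exp (1 / 4 + gaussianSqConst / 16)

/-- At scale `τ = 1/(4√n)` one has `n τ² = 1/16`, so the bound for sums of centred squares does not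
depend on `n`. The `1/4` in `expMomentConst` pays for `sqDev` being centred at `n - 1` rather than
`n`, and the factor `2` for the two signs. -/
theorem integral_exp_abs_sqDev_le {n : ℕ} (hn : 1 ≤ n) :
    Integrable (fun x : Fin n → ℝ => Real.exp (1 / (4 * √n) * |sqDev x|)) (stdGauss n) ∧
      ∫ x : Fin n → ℝ, Real.exp (1 / (4 * √n) * |sqDev x|) ∂stdGauss n ≤ 2 * expMomentConst := by
  have hn' : (1 : ℝ) ≤ n := by exact_mod_cast hn
  have hs : 1 ≤ √(n : ℝ) := Real.one_le_sqrt.2 hn'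
  set τ : ℝ := 1 / (4 * √n) with hτ
  have hτ0 : 0 < τ := by positivity
  have hτ1 : τ ≤ 1 / 4 := by
    rw [hτ, div_le_div_iff₀ (by positivity) (by norm_num)]; linarith
  have hτ2 : n * τ ^ 2 = 1 / 16 := by
    rw [hτ, div_pow, mul_pow, Real.sq_sqrt (by linarith)]; field_simp; norm_num
  have key : ∀ c : ℝ, |c| = τ →
      Integrable (fun x : Fin n → ℝ => Real.exp (c * sqDev x)) (stdGauss n) ∧
      ∫ x : Fin n → ℝ, Real.exp (c * sqDev x) ∂stdGauss n ≤ expMomentConst := by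
    intro c hc
    have h := integral_exp_sum_sq_sub_one_le (n := n) (c := fun _ => c) (fun _ => hc ▸ hτ1)
    have e : ∀ x : Fin n → ℝ, Real.exp (c * sqDev x)
        = Real.exp c * Real.exp (∑ j, c * (x j ^ 2 - 1)) := by
      intro x
      rw [← Real.exp_add, ← Finset.mul_sum, Finset.sum_sub_distrib, sqDev]
      simp
      ring
    simp_rw [e]
    refine ⟨h.1.const_mul _, ?_⟩
    rw [integral_const_mul]
    calc _ ≤ Real.exp c * Real.exp (∑ _j : Fin n, c ^ 2 * gaussianSqConst) :=
          mul_le_mul_of_nonneg_left h.2 (Real.exp_pos _).le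
      _ ≤ _ := by
        rw [← Real.exp_add, expMomentConst, Real.exp_le_exp, ← sq_abs, hc]
        simp only [Finset.sum_const, Finset.card_univ, Fintype.card_fin, nsmul_eq_mul]
        rw [← mul_assoc, hτ2]
        linarith [le_abs_self c]
  obtain ⟨p1, p2⟩ := key τ (abs_of_pos hτ0)
  obtain ⟨m1, m2⟩ := key (-τ) (by rw [abs_neg, abs_of_pos hτ0])
  have hle : ∀ x : Fin n → ℝ,
      Real.exp (τ * |sqDev x|) ≤ Real.exp (τ * sqDev x) + Real.exp (-τ * sqDev x) := by
    intro x
    rcases abs_cases (sqDev x) with ⟨h, _⟩ | ⟨h, _⟩ <;> rw [h]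
    · linarith [Real.exp_pos (-τ * sqDev x)]
    · rw [mul_neg, ← neg_mul]; linarith [Real.exp_pos (τ * sqDev x)]
  have hi : Integrable (fun x : Fin n → ℝ => Real.exp (τ * |sqDev x|)) (stdGauss n) := by
    refine (p1.add m1).mono' ?_ (Filter.Eventually.of_forall fun x => ?_)
    · exact (Real.measurable_exp.comp
        ((measurable_sqDev.norm).const_mul τ)).aestronglyMeasurable
    · rw [Real.norm_eq_abs, abs_of_pos (Real.exp_pos _)]; exact hle x
  refine ⟨hi, (integral_mono hi (p1.add m1) hle).trans ?_⟩
  rw [integral_add' p1 m1]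
  linarith

/-- The contribution of a row to the quadratic form at `u`, truncated to `|sqDev| ≤ B`. -/
noncomputable def truncTerm {n : ℕ} (B : ℝ) (u x : Fin n → ℝ) : ℝ :=
  if |sqDev x| ≤ B then sqDev x * (∑ j, u j * x j) ^ 2 else 0

theorem measurable_truncTerm {n : ℕ} (B : ℝ) (u : Fin n → ℝ) : Measurable (truncTerm B u) :=
  Measurable.ite (measurableSet_le measurable_sqDev.norm measurable_const)
    (measurable_sqDev.mul ((measurable_linear u).pow_const 2)) measurable_const

theorem abs_truncTerm_le {n : ℕ} {B : ℝ} (hB : 0 ≤ B) (u x : Fin n → ℝ) :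
    |truncTerm B u x| ≤ B * ((∑ j, u j * x j) ^ 2 + 1) := by
  unfold truncTerm
  split_ifs with h
  · rw [abs_mul, abs_of_nonneg (sq_nonneg (∑ j, u j * x j))]
    nlinarith [mul_le_mul_of_nonneg_right h (sq_nonneg (∑ j, u j * x j))]
  · rw [abs_zero]; positivity

/-- After truncation the term is dominated by `B (g² + 1)` with `g` a standard Gaussian, so the
Bernstein type bound applies with `t = |l| B`. -/
theorem integral_exp_truncTerm_le {n : ℕ} {B l : ℝ} (hB : 0 ≤ B) (hl : |l| * B ≤ 1 / 4)
    {u : Fin n → ℝ} (hu : ∑ j, u j ^ 2 = 1) :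
    Integrable (fun x => Real.exp (l * truncTerm B u x)) (stdGauss n) ∧
      ∫ x, Real.exp (l * truncTerm B u x) ∂stdGauss n
        ≤ Real.exp (l * ∫ x, truncTerm B u x ∂stdGauss n + (|l| * B) ^ 2 * gaussianSqConst) := by
  have hm := measurePreserving_linear hu
  have hI : ∫ x, ((∑ j, u j * x j) ^ 2 + 1) ^ 2 * Real.exp (((∑ j, u j * x j) ^ 2 + 1) / 4)
      ∂stdGauss n = gaussianSqConst := by
    rw [← integral_map (f := fun y : ℝ => (y ^ 2 + 1) ^ 2 * Real.exp ((y ^ 2 + 1) / 4))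
      (measurable_linear u).aemeasurable (by fun_prop), hm.map_eq, gaussianSqConst]
  have h := integral_exp_le_of_abs_le (μ := stdGauss n) (X := fun x => l * truncTerm B u x)
    (Y := fun x => (∑ j, u j * x j) ^ 2 + 1) (t := |l| * B)
    ((measurable_truncTerm B u).const_mul l) (by positivity) hl
    (fun x => by
      rw [abs_mul, mul_assoc]
      exact mul_le_mul_of_nonneg_left (abs_truncTerm_le hB u x) (abs_nonneg _))
    (hm.integrable_comp_of_integrable integrable_sq_add_one_sq_mul_exp_gaussianReal)
    (fun x => by positivity)
  rw [hI, integral_const_mul] at h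
  exact ⟨h.1, h.2.2⟩

/-- Let `D = sqDev x`, `g = ⟨u, x⟩`, `E = exp (|D|/(16√n))` and `F = exp (-B/(16√n))`. Where
truncation acts, `|D| ≤ 16√n E` and `1 ≤ F E`, so `|D| g² ≤ 16√n F E² g² ≤ 8√n F (E⁴ + g⁴)`. Both
`E⁴` and `g⁴` have bounded means. -/
theorem abs_integral_truncTerm_sub_le {n : ℕ} (hn : 1 ≤ n) (B : ℝ)
    {u : Fin n → ℝ} (hu : ∑ j, u j ^ 2 = 1) :
    |∫ x, truncTerm B u x ∂stdGauss n - 3|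
      ≤ Real.exp (-(B / (16 * √n))) * (8 * √n) * (2 * expMomentConst + 3) := by
  have hn' : (1 : ℝ) ≤ n := by exact_mod_cast hn
  have hs : 1 ≤ √(n : ℝ) := Real.one_le_sqrt.2 hn'
  obtain ⟨d1, d2⟩ := integral_sqDev_mul_linear_sq hu
  obtain ⟨e1, e2⟩ := integral_exp_abs_sqDev_le hn
  obtain ⟨f1, f2⟩ := integral_linear_pow_four u
  rw [hu] at f2
  have hbd : ∀ x : Fin n → ℝ, ‖truncTerm B u x - sqDev x * (∑ j, u j * x j) ^ 2‖
      ≤ Real.exp (-(B / (16 * √n))) * (8 * √n)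
        * (Real.exp (1 / (4 * √n) * |sqDev x|) + (∑ j, u j * x j) ^ 4) := by
    intro x
    set D := sqDev x
    set g := ∑ j, u j * x j
    unfold truncTerm
    split_ifs with h
    · simp only [D, g, sub_self, norm_zero]; positivity
    · rw [zero_sub, norm_neg, Real.norm_eq_abs, abs_mul, abs_of_nonneg (sq_nonneg g)]
      push Not at h
      have a1 : |D| ≤ 16 * √n * Real.exp (|D| / (16 * √n)) := by
        have := Real.add_one_le_exp (|D| / (16 * √n))
        have h2 : |D| = 16 * √n * (|D| / (16 * √n)) := by field_simp
        calc |D| = 16 * √n * (|D| / (16 * √n)) := h2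
          _ ≤ _ := by gcongr; linarith
      have a2 : (1 : ℝ) ≤ Real.exp (-(B / (16 * √n))) * Real.exp (|D| / (16 * √n)) := by
        rw [← Real.exp_add]
        refine Real.one_le_exp ?_
        have : B / (16 * √n) ≤ |D| / (16 * √n) := by gcongr
        linarith
      have a3 : Real.exp (1 / (4 * √n) * |D|) = Real.exp (|D| / (16 * √n)) ^ 4 := by
        rw [← Real.exp_nat_mul]; congr 1; push_cast; field_simp; ring
      rw [a3]
      set E := Real.exp (|D| / (16 * √n))
      set F := Real.exp (-(B / (16 * √n)))
      have hE : 0 < E := Real.exp_pos _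
      have hF : 0 < F := Real.exp_pos _
      calc |D| * g ^ 2 ≤ 16 * √n * E * g ^ 2 * 1 := by
            rw [mul_one]; exact mul_le_mul_of_nonneg_right a1 (sq_nonneg _)
        _ ≤ 16 * √n * E * g ^ 2 * (F * E) := by
            exact mul_le_mul_of_nonneg_left a2 (by positivity)
        _ = F * (8 * √n) * (2 * (E ^ 2 * g ^ 2)) := by ring
        _ ≤ _ := by
            refine mul_le_mul_of_nonneg_left ?_ (by positivity)
            nlinarith [sq_nonneg (E ^ 2 - g ^ 2)]
  have hR := (e1.add f1).const_mul (Real.exp (-(B / (16 * √n))) * (8 * √n))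
  have hdi : Integrable (fun x => truncTerm B u x - sqDev x * (∑ j, u j * x j) ^ 2)
      (stdGauss n) :=
    hR.mono' ((measurable_truncTerm B u).sub
      (measurable_sqDev.mul ((measurable_linear u).pow_const 2))).aestronglyMeasurable
      (Filter.Eventually.of_forall hbd)
  have hti : Integrable (truncTerm B u) (stdGauss n) := by
    refine (hdi.add d1).congr (Filter.Eventually.of_forall fun x => ?_)
    simp
  rw [← d2, ← integral_sub hti d1, ← Real.norm_eq_abs]
  refine (norm_integral_le_of_norm_le hR (Filter.Eventually.of_forall hbd)).trans ?_
  rw [integral_const_mul, integral_add' e1 f1, f2]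
  refine mul_le_mul_of_nonneg_left ?_ (by positivity)
  linarith

theorem measureReal_abs_sqDev_gt_le {n : ℕ} (hn : 1 ≤ n) (B : ℝ) :
    (stdGauss n).real {x | B < |sqDev x|}
      ≤ 2 * expMomentConst * Real.exp (-(B / (4 * √n))) := by
  have hn' : (1 : ℝ) ≤ n := by exact_mod_cast hn
  have hs : 1 ≤ √(n : ℝ) := Real.one_le_sqrt.2 hn'
  obtain ⟨e1, e2⟩ := integral_exp_abs_sqDev_le hn
  have hM : 0 < 2 * expMomentConst := mul_pos two_pos (Real.exp_pos _)
  have h := measureReal_le_exp_of_integral_exp_le (a := Real.log (2 * expMomentConst))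
    (s := B / (4 * √n)) e1 (by rwa [Real.exp_log hM])
  rw [sub_eq_add_neg, Real.exp_add, Real.exp_log hM] at h
  refine (measureReal_mono fun x hx => ?_).trans h
  simp only [Set.mem_ofPred_eq] at hx ⊢
  rw [one_div_mul_eq_div]
  gcongr

/-! ### Nets of the sphere and the spectral norm -/

/-- The unit sphere of a finite-dimensional space has a `1/2`-net with at most `5 ^ dim` points. -/
theorem exists_half_net_sphere (E : Type*) [NormedAddCommGroup E] [NormedSpace ℝ E]
    [FiniteDimensional ℝ E] :
    ∃ s : Finset E, s.card ≤ 5 ^ Module.finrank ℝ E ∧ (∀ x ∈ s, ‖x‖ = 1) ∧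
      ∀ x : E, ‖x‖ = 1 → ∃ y ∈ s, ‖x - y‖ ≤ 1 / 2 := by
  classical
  let P : Finset E → Prop := fun s =>
    (∀ x ∈ s, ‖x‖ = 1) ∧ ∀ x ∈ s, ∀ y ∈ s, x ≠ y → 1 / 2 ≤ ‖x - y‖
  have hcard : ∀ s, P s → s.card ≤ 5 ^ Module.finrank ℝ E := by
    intro s hs
    -- Doubling turns a `1/2`-separated set in the unit sphere into a `1`-separated set in the ball
    -- of radius `2`, the normalization of `Besicovitch.card_le_of_separated`.
    have h2 : Function.Injective fun x : E => (2 : ℝ) • x := smul_right_injective E two_ne_zero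
    rw [← Finset.card_image_of_injective s h2]
    refine Besicovitch.card_le_of_separated _ ?_ ?_
    · intro c hc
      obtain ⟨x, hx, rfl⟩ := Finset.mem_image.1 hc
      rw [norm_smul, hs.1 x hx]; norm_num
    · intro c hc d hd hcd
      obtain ⟨x, hx, rfl⟩ := Finset.mem_image.1 hc
      obtain ⟨y, hy, rfl⟩ := Finset.mem_image.1 hd
      rw [← smul_sub, norm_smul]
      have := hs.2 x hx y hy (fun h => hcd (by rw [h]))
      norm_num
      linarith
  -- A separated set of maximal cardinality is a net: a point far from all its members could be
  -- added.
  obtain ⟨k, ⟨s, hs, hk⟩, hmax⟩ : ∃ k, (∃ s, P s ∧ s.card = k) ∧ ∀ s, P s → s.card ≤ k := by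
    have hex : ∃ s, P s ∧ s.card = 0 := ⟨∅, by simp [P], rfl⟩
    let Q : ℕ → Prop := fun k => ∃ s, P s ∧ s.card = k
    refine ⟨Nat.findGreatest Q (5 ^ Module.finrank ℝ E),
      Nat.findGreatest_spec (P := Q) (Nat.zero_le _) hex, fun s hs => ?_⟩
    exact Nat.le_findGreatest (P := Q) (hcard s hs) ⟨s, hs, rfl⟩
  refine ⟨s, hcard s hs, hs.1, fun x hx => ?_⟩
  by_contra! hfar
  have hxs : x ∉ s := fun h => by
    have := hfar x h
    rw [sub_self, norm_zero] at this
    linarith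
  have : P (insert x s) := by
    refine ⟨fun y hy => ?_, fun y hy z hz hyz => ?_⟩
    · rcases Finset.mem_insert.1 hy with rfl | hy
      · exact hx
      · exact hs.1 y hy
    · rcases Finset.mem_insert.1 hy with rfl | hy' <;> rcases Finset.mem_insert.1 hz with rfl | hz'
      · exact absurd rfl hyz
      · exact (hfar z hz').le
      · rw [norm_sub_rev]; exact (hfar y hy').le
      · exact hs.2 y hy' z hz' hyz
  have := hmax _ this
  rw [Finset.card_insert_of_notMem hxs] at this
  omega

open scoped InnerProductSpace in
-- By symmetry `⟪T x, x⟫ - ⟪T y, y⟫ = ⟪T (x + y), x - y⟫`. For unit vectors at distance at most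
-- `1/2`, the parallelogram law gives `‖x + y‖ ‖x - y‖ ≤ √(15/16) ≤ 33/34`. Hence `‖T‖ ≤ a + (33/34)
-- ‖T‖`, so a net as coarse as `1/2` suffices, at the cost of the factor `34`.
theorem norm_le_of_net {E : Type*} [NormedAddCommGroup E] [InnerProductSpace ℝ E]
    {T : E →L[ℝ] E} (hT : ∀ x y, ⟪T x, y⟫_ℝ = ⟪x, T y⟫_ℝ) {s : Finset E} {a : ℝ} (ha : 0 ≤ a)
    (hs1 : ∀ y ∈ s, ‖y‖ = 1) (hs : ∀ x : E, ‖x‖ = 1 → ∃ y ∈ s, ‖x - y‖ ≤ 1 / 2)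
    (h : ∀ y ∈ s, |⟪T y, y⟫_ℝ| ≤ a) : ‖T‖ ≤ 34 * a := by
  set b : ℝ := a + 33 / 34 * ‖T‖ with hb
  have hunit : ∀ x : E, ‖x‖ = 1 → |⟪T x, x⟫_ℝ| ≤ b := by
    intro x hx
    obtain ⟨y, hy, hxy⟩ := hs x hx
    have hy1 := hs1 y hy
    have e : ⟪T x, x⟫_ℝ = ⟪T y, y⟫_ℝ + ⟪T (x + y), x - y⟫_ℝ := by
      simp only [map_add, inner_add_left, inner_sub_right]
      have : ⟪T x, y⟫_ℝ = ⟪T y, x⟫_ℝ := by rw [hT, real_inner_comm]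
      linarith
    have hpar : ‖x + y‖ * ‖x - y‖ ≤ 33 / 34 := by
      have h1 := parallelogram_law_with_norm ℝ x y
      rw [hx, hy1] at h1
      have h2 := norm_nonneg (x + y)
      have h3 := norm_nonneg (x - y)
      refine abs_le_of_sq_le_sq' ?_ (by norm_num) |>.2
      have h4 : ‖x - y‖ ^ 2 ≤ 1 / 4 := by nlinarith
      have h5 : ‖x + y‖ ^ 2 = 4 - ‖x - y‖ ^ 2 := by nlinarith
      rw [mul_pow, h5]
      nlinarith [sq_nonneg ‖x - y‖]
    have h6 : |⟪T (x + y), x - y⟫_ℝ| ≤ 33 / 34 * ‖T‖ := by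
      refine (abs_real_inner_le_norm _ _).trans ?_
      calc ‖T (x + y)‖ * ‖x - y‖ ≤ (‖T‖ * ‖x + y‖) * ‖x - y‖ := by
            gcongr; exact T.le_opNorm _
        _ = ‖T‖ * (‖x + y‖ * ‖x - y‖) := by ring
        _ ≤ ‖T‖ * (33 / 34) := by gcongr
        _ = _ := by ring
    rw [e]
    exact (abs_add_le _ _).trans (add_le_add (h y hy) h6)
  have hb0 : 0 ≤ b := by positivity
  have hquad : ∀ x : E, |⟪T x, x⟫_ℝ| ≤ b * ‖x‖ ^ 2 := by
    intro x
    rcases eq_or_ne x 0 with rfl | hx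
    · simp
    · have hx' : ‖x‖ ≠ 0 := norm_ne_zero_iff.2 hx
      have := hunit (‖x‖⁻¹ • x) (by rw [norm_smul, norm_inv, norm_norm, inv_mul_cancel₀ hx'])
      rw [map_smul, real_inner_smul_left, real_inner_smul_right, abs_mul, abs_mul, abs_inv,
        abs_norm] at this
      have hp : 0 < ‖x‖ := norm_pos_iff.2 hx
      calc |⟪T x, x⟫_ℝ| = (‖x‖⁻¹ * (‖x‖⁻¹ * |⟪T x, x⟫_ℝ|)) * ‖x‖ ^ 2 := by field_simp
        _ ≤ _ := by gcongr
  have hbil : ∀ x y : E, ⟪T x, y⟫_ℝ ≤ b * (‖x‖ ^ 2 + ‖y‖ ^ 2) / 2 := by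
    intro x y
    have h1 := (abs_le.1 (hquad (x + y))).2
    have h2 := (abs_le.1 (hquad (x - y))).1
    have h3 := parallelogram_law_with_norm ℝ x y
    have : ⟪T x, y⟫_ℝ = ⟪T y, x⟫_ℝ := by rw [hT, real_inner_comm]
    simp only [map_add, map_sub, inner_add_left, inner_add_right, inner_sub_left,
      inner_sub_right] at h1 h2
    nlinarith
  have hTb : ‖T‖ ≤ b := by
    refine ContinuousLinearMap.opNorm_le_bound T hb0 fun x => ?_
    rcases eq_or_ne (T x) 0 with h0 | h0
    · rw [h0, norm_zero]; positivity
    rcases eq_or_ne x 0 with rfl | hx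
    · simp
    have hp : 0 < ‖x‖ := norm_pos_iff.2 hx
    have hq : 0 < ‖T x‖ := norm_pos_iff.2 h0
    -- The test vector points along `T x` and has the length of `x`, so the polarized bound becomes
    -- `‖x‖ ‖T x‖ ≤ b ‖x‖²`.
    have := hbil x ((‖x‖ / ‖T x‖) • T x)
    rw [real_inner_smul_right, real_inner_self_eq_norm_sq, norm_smul, norm_div, norm_norm,
      norm_norm, div_mul_cancel₀ _ hq.ne'] at this
    have e : ‖x‖ / ‖T x‖ * ‖T x‖ ^ 2 = ‖x‖ * ‖T x‖ := by field_simp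
    rw [e] at this
    refine le_of_mul_le_mul_left ?_ hp
    linarith
  linarith

theorem sum_sq_eq_one_of_norm {n : ℕ} {u : EuclideanSpace ℝ (Fin n)} (hu : ‖u‖ = 1) :
    ∑ j, u j ^ 2 = 1 := by
  have := EuclideanSpace.real_norm_sq_eq u
  rw [← this, hu, one_pow]

open Matrix in
/-- The quadratic form of `spectralMatrix Y`. -/
theorem dotProduct_spectralMatrix_mulVec {N n : ℕ} (Y : Matrix (Fin N) (Fin n) ℝ)
    (u : Fin n → ℝ) :
    u ⬝ᵥ spectralMatrix Y *ᵥ u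
      = ∑ i, ((∑ j, Y i j ^ 2) - ((n : ℝ) - 1) / N) * (∑ j, u j * Y i j) ^ 2
        - 3 / N * ∑ j, u j ^ 2 := by
  rw [spectralMatrix, Matrix.sub_mulVec, dotProduct_sub, Matrix.sum_mulVec, dotProduct_sum]
  congr 1
  · refine Finset.sum_congr rfl fun i _ => ?_
    rw [Matrix.smul_mulVec, dotProduct_smul, Matrix.vecMulVec_mulVec, smul_eq_mul]
    congr 1
    simp [dotProduct, sq, Finset.mul_sum, mul_comm, mul_left_comm]
  · rw [Matrix.smul_mulVec, dotProduct_smul, Matrix.one_mulVec, smul_eq_mul]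
    simp [dotProduct, sq]

theorem isSymm_spectralMatrix {N n : ℕ} (Y : Matrix (Fin N) (Fin n) ℝ) :
    (spectralMatrix Y).transpose = spectralMatrix Y := by
  simp only [spectralMatrix, Matrix.transpose_sub, Matrix.transpose_sum, Matrix.transpose_smul,
    Matrix.transpose_vecMulVec, Matrix.transpose_one]

theorem specNorm_le_of_net {n : ℕ} {M : Matrix (Fin n) (Fin n) ℝ} (hM : M.transpose = M)
    {s : Finset (EuclideanSpace ℝ (Fin n))} {a : ℝ} (ha : 0 ≤ a) (hs1 : ∀ y ∈ s, ‖y‖ = 1)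
    (hs : ∀ x : EuclideanSpace ℝ (Fin n), ‖x‖ = 1 → ∃ y ∈ s, ‖x - y‖ ≤ 1 / 2)
    (h : ∀ y ∈ s, |(y : Fin n → ℝ) ⬝ᵥ M.mulVec y| ≤ a) : specNorm M ≤ 34 * a := by
  refine norm_le_of_net (fun x y => ?_) ha hs1 hs fun y hy => ?_
  · rw [real_inner_comm, Matrix.inner_toEuclideanCLM, Matrix.inner_toEuclideanCLM,
      Matrix.dotProduct_mulVec, ← Matrix.mulVec_transpose, hM, dotProduct_comm]
  · rw [real_inner_comm, Matrix.inner_toEuclideanCLM]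
    exact h y hy

theorem abs_dotProduct_mulVec_le_specNorm {n : ℕ} (M : Matrix (Fin n) (Fin n) ℝ)
    {u : Fin n → ℝ} (hu : ∑ j, u j ^ 2 = 1) : |u ⬝ᵥ M.mulVec u| ≤ specNorm M := by
  have h1 : ‖WithLp.toLp 2 u‖ = 1 := by
    rw [EuclideanSpace.norm_eq]; simp [hu]
  have h := Matrix.inner_toEuclideanCLM M (WithLp.toLp 2 u) (WithLp.toLp 2 u)
  simp only at h
  rw [← h]
  refine (abs_real_inner_le_norm _ _).trans ?_
  rw [h1, one_mul]
  refine (ContinuousLinearMap.le_opNorm _ _).trans ?_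
  rw [h1, mul_one, specNorm]

theorem continuous_specNorm {n : ℕ} : Continuous (specNorm (n := n)) := by
  let f : Matrix (Fin n) (Fin n) ℝ →ₗ[ℝ]
      (EuclideanSpace ℝ (Fin n) →L[ℝ] EuclideanSpace ℝ (Fin n)) :=
    { toFun := Matrix.toEuclideanCLM (n := Fin n) (𝕜 := ℝ)
      map_add' := map_add _
      map_smul' := map_smul _ }
  have h : Continuous f := LinearMap.continuous_of_finiteDimensional f
  exact continuous_norm.comp h

theorem measurable_specNorm_spectralMatrix {N n : ℕ} :
    Measurable fun Y : Matrix (Fin N) (Fin n) ℝ => specNorm (spectralMatrix Y) := by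
  refine continuous_specNorm.measurable.comp (Continuous.measurable ?_)
  unfold spectralMatrix Matrix.vecMulVec
  fun_prop

/-! ### Deviation of the spectral norm under the null law -/

/-- The law of an `N × n` matrix with i.i.d. standard Gaussian entries. -/
noncomputable abbrev stdGaussMatrix (N n : ℕ) : Measure (Fin N → Fin n → ℝ) :=
  Measure.pi fun _ => stdGauss n

/-- Division of all entries by `√N`. -/
noncomputable def scaleRows {N n : ℕ} (X : Fin N → Fin n → ℝ) : Matrix (Fin N) (Fin n) ℝ :=
  Matrix.of fun i j => X i j / √N

theorem measurable_scaleRows {N n : ℕ} : Measurable (scaleRows (N := N) (n := n)) :=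
  measurable_pi_iff.2 fun i => measurable_pi_iff.2 fun j => by
    simp only [scaleRows, Matrix.of_apply]
    exact ((measurable_pi_apply j).comp (measurable_pi_apply i)).div_const _

theorem map_scaleRows {N n : ℕ} :
    (stdGaussMatrix N n).map scaleRows = gaussianMatrix N n := by
  have h1 : (gaussianReal 0 1).map (fun x => x / √N) = gaussianReal 0 (N : NNReal)⁻¹ := by
    rw [gaussianReal_map_div_const]
    congr 1
    · simp
    · ext; simp
  have h2 : (stdGauss n).map (fun x j => x j / √N)
      = Measure.pi fun _ => gaussianReal 0 (N : NNReal)⁻¹ := by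
    have : SigmaFinite ((gaussianReal 0 1).map (fun x => x / √N)) := by rw [h1]; infer_instance
    rw [stdGauss, Measure.pi_map_pi (μ := fun _ : Fin n => gaussianReal 0 1)
      (f := fun _ x => x / √N) (fun _ => by fun_prop)]
    simp_rw [h1]
  have : SigmaFinite ((stdGauss n).map (fun x j => x j / √N)) := by rw [h2]; infer_instance
  have h3 := Measure.pi_map_pi (μ := fun _ : Fin N => stdGauss n)
    (f := fun _ x j => x j / √N)
    (fun _ => (measurable_pi_iff.2 fun j => (measurable_pi_apply j).div_const _).aemeasurable)
  simp_rw [h2] at h3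
  exact h3

theorem dotProduct_spectralMatrix_scaleRows {N n : ℕ} (hN : 1 ≤ N) (X : Fin N → Fin n → ℝ)
    {u : Fin n → ℝ} (hu : ∑ j, u j ^ 2 = 1) :
    u ⬝ᵥ (spectralMatrix (scaleRows X)).mulVec u
      = (∑ i, sqDev (X i) * (∑ j, u j * X i j) ^ 2 - 3 * N) / (N : ℝ) ^ 2 := by
  have hN' : (0 : ℝ) < N := by exact_mod_cast hN
  rw [dotProduct_spectralMatrix_mulVec, hu, sub_div (∑ i, sqDev (X i) * _), Finset.sum_div]
  congr 1
  · refine Finset.sum_congr rfl fun i _ => ?_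
    simp only [scaleRows, Matrix.of_apply, div_pow, Real.sq_sqrt hN'.le, mul_div_assoc', ← Finset.sum_div, sqDev]
    field_simp
  · field_simp

theorem measureReal_abs_sum_truncTerm_sub_ge_le {N n : ℕ} (hn : 1 ≤ n) {B s t : ℝ}
    (hB : 0 ≤ B) (hs : 0 < s) (ht : 0 ≤ t)
    (h1 : N * (Real.exp (-(B / (16 * √n))) * (8 * √n) * (2 * expMomentConst + 3)) ≤ s / 4)
    (h2 : 8 * B * t ≤ s) (h3 : 8 * gaussianSqConst * N * B ^ 2 * t ≤ s ^ 2)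
    {u : Fin n → ℝ} (hu : ∑ j, u j ^ 2 = 1) :
    (stdGaussMatrix N n).real {X | s ≤ |∑ i, truncTerm B u (X i) - 3 * N|}
      ≤ 2 * Real.exp (-t) := by
  set m := ∫ x, truncTerm B u x ∂stdGauss n with hm
  -- With this Chernoff parameter the threshold contributes `-l s = -2t` to the exponent, while the
  -- variance term (by `h3`) and the bias (by `h1`) contribute at most `t/2` each. `h2` is the
  -- admissibility condition `l B ≤ 1/4`.
  set l := 2 * t / s with hl
  have hl0 : 0 ≤ l := by positivity
  have hls : l * s = 2 * t := by rw [hl]; field_simp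
  have hlB : l * B ≤ 1 / 4 := by
    rw [hl, div_mul_eq_mul_div, div_le_iff₀ hs]; linarith
  have hquad : N * ((l * B) ^ 2 * gaussianSqConst) ≤ t / 2 := by
    have e : N * ((l * B) ^ 2 * gaussianSqConst)
        = (8 * gaussianSqConst * N * B ^ 2 * t) * (t / (2 * s ^ 2)) := by
      rw [hl]; field_simp; ring
    rw [e]
    calc _ ≤ s ^ 2 * (t / (2 * s ^ 2)) := by gcongr
      _ = t / 2 := by field_simp
  have hbias : N * |m - 3| ≤ s / 4 :=
    (mul_le_mul_of_nonneg_left (abs_integral_truncTerm_sub_le hn B hu)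
      (Nat.cast_nonneg N)).trans h1
  have side : ∀ e : ℝ, |e| = 1 →
      (stdGaussMatrix N n).real {X | s ≤ e * (∑ i, truncTerm B u (X i) - 3 * N)}
        ≤ Real.exp (-t) := by
    intro e he
    have habs : |e * l| = l := by rw [abs_mul, he, one_mul, abs_of_nonneg hl0]
    have key := integral_exp_truncTerm_le (l := e * l) hB (by rwa [habs]) hu
    rw [habs] at key
    have hc := measureReal_pi_sum_ge_le (μ := fun _ : Fin N => stdGauss n)
      (f := fun _ x => e * l * truncTerm B u x) (s := l * s + e * l * (3 * N))
      (fun _ => key.1) (fun _ => key.2)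
    refine (measureReal_mono fun X hX => ?_).trans (hc.trans (Real.exp_le_exp.2 ?_))
    · simp only [Set.mem_ofPred_eq] at hX ⊢
      rw [← Finset.mul_sum]
      nlinarith [mul_le_mul_of_nonneg_left hX hl0]
    · simp only [Finset.sum_const, Finset.card_univ, Fintype.card_fin, nsmul_eq_mul]
      have h4 : e * (N * (m - 3)) ≤ s / 4 := by
        refine (le_abs_self _).trans ?_
        rwa [abs_mul, he, one_mul, abs_mul, Nat.abs_cast]
      have h5 := mul_le_mul_of_nonneg_left h4 hl0
      rw [mul_add]
      linarith
  refine (measureReal_mono (s₂ := {X | s ≤ 1 * (∑ i, truncTerm B u (X i) - 3 * N)} ∪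
    {X | s ≤ -1 * (∑ i, truncTerm B u (X i) - 3 * N)}) fun X hX => ?_).trans
    ((measureReal_union_le _ _).trans ?_)
  · simp only [Set.mem_ofPred_eq, Set.mem_union, one_mul, neg_mul] at hX ⊢
    exact le_abs.1 hX
  · linarith [side 1 (by simp), side (-1) (by simp)]

/-- The first error term pays for some row exceeding the truncation level, the second for a large
deviation at some net point. Off these events the truncated and true quadratic forms agree on the
whole net. -/
theorem nullLaw_specNorm_gt_le {N n : ℕ} (hn : 1 ≤ n) (hN : 1 ≤ N) {B s t : ℝ}
    (hB : 0 ≤ B) (hs : 0 < s) (ht : 0 ≤ t)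
    (h1 : N * (Real.exp (-(B / (16 * √n))) * (8 * √n) * (2 * expMomentConst + 3)) ≤ s / 4)
    (h2 : 8 * B * t ≤ s) (h3 : 8 * gaussianSqConst * N * B ^ 2 * t ≤ s ^ 2) :
    (nullLaw N n).real {Y | specNorm (spectralMatrix Y) > 34 * (s / (N : ℝ) ^ 2)}
      ≤ N * (2 * expMomentConst * Real.exp (-(B / (4 * √n)))) + 5 ^ n * (2 * Real.exp (-t)) := by
  obtain ⟨S, hcard, hS1, hS⟩ := exists_half_net_sphere (EuclideanSpace ℝ (Fin n))
  rw [finrank_euclideanSpace, Fintype.card_fin] at hcard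
  rw [nullLaw, ← map_scaleRows, map_measureReal_apply measurable_scaleRows
    (measurableSet_lt measurable_const measurable_specNorm_spectralMatrix)]
  have hsub : scaleRows ⁻¹' {Y | specNorm (spectralMatrix Y) > 34 * (s / (N : ℝ) ^ 2)}
      ⊆ (⋃ i ∈ (Finset.univ : Finset (Fin N)), {X : Fin N → Fin n → ℝ | B < |sqDev (X i)|}) ∪
        ⋃ y ∈ S, {X : Fin N → Fin n → ℝ |
          s ≤ |∑ i, truncTerm B (y : Fin n → ℝ) (X i) - 3 * N|} := by
    intro X hX
    by_contra hcon
    simp only [Set.mem_union, Set.mem_iUnion, Set.mem_ofPred_eq, not_or, not_exists, not_lt,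
      not_le, Finset.mem_univ, true_imp_iff] at hcon
    obtain ⟨hD, hnet⟩ := hcon
    refine absurd hX ?_
    simp only [Set.mem_preimage, Set.mem_ofPred_eq, not_lt, gt_iff_lt]
    refine specNorm_le_of_net (isSymm_spectralMatrix _) (by positivity) hS1 hS fun y hy => ?_
    rw [dotProduct_spectralMatrix_scaleRows hN X (sum_sq_eq_one_of_norm (hS1 y hy)), abs_div,
      abs_of_nonneg (sq_nonneg (N : ℝ))]
    gcongr
    have := (hnet y hy).le
    simp only [truncTerm, hD _, if_true] at this
    exact this
  refine (measureReal_mono hsub).trans ((measureReal_union_le _ _).trans (add_le_add ?_ ?_))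
  · refine (measureReal_biUnion_finset_le _ _).trans ?_
    refine (Finset.sum_le_card_nsmul _ _ (2 * expMomentConst * Real.exp (-(B / (4 * √n))))
      fun i _ => ?_).trans (by simp)
    have hmp := measurePreserving_eval (fun _ : Fin N => stdGauss n) i
    refine le_trans (le_of_eq ?_) (measureReal_abs_sqDev_gt_le hn B)
    exact hmp.measureReal_preimage
      (measurableSet_lt measurable_const measurable_sqDev.norm).nullMeasurableSet
  · refine (measureReal_biUnion_finset_le _ _).trans ?_
    refine (Finset.sum_le_card_nsmul _ _ (2 * Real.exp (-t)) fun y hy =>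
      measureReal_abs_sum_truncTerm_sub_ge_le hn hB hs ht h1 h2 h3
        (sum_sq_eq_one_of_norm (hS1 y hy))).trans ?_
    rw [nsmul_eq_mul]
    gcongr
    exact_mod_cast hcard

/-! ### Choice of parameters for the null law -/

/-- The consequences of the scaling assumptions that are used below. -/
theorem scaling_bounds {N n : ℕ} {ρ δ c N₀ : ℝ} (hn : 1 ≤ n) (hnN : n ≤ N) (hρ : 0 < ρ)
    (hδ : 0 < δ) (hδ' : δ < 1 / 2) (hlog : Real.log (N / δ) ^ 7 ≤ N)
    (h : (n * ρ / √N + √(n / N)) * Real.log (N / δ) ≤ c) (hN₀ : 3 ≤ N₀)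
    (hc : c ≤ 1 / (2 * √N₀)) :
    N₀ ≤ N ∧ 1 ≤ Real.log (N / δ) ∧ Real.log (N / δ) ^ 2 ≤ √N ∧
      Real.exp (-Real.log (N / δ)) = δ / N ∧
      n * ρ * Real.log (N / δ) ≤ c * √N ∧ √n * Real.log (N / δ) ≤ c * √N := by
  have hn' : (1 : ℝ) ≤ n := by exact_mod_cast hn
  have hN : (1 : ℝ) ≤ N := by exact_mod_cast hn.trans hnN
  have hN0 : (0 : ℝ) < N := by linarith
  set L := Real.log (N / δ) with hL
  have hb : 0 < √(N : ℝ) := Real.sqrt_pos.2 hN0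
  have hND : (2 : ℝ) ≤ N / δ := by rw [le_div_iff₀ hδ]; linarith
  have hL2 : 1 / 2 ≤ L := by
    have h1 := Real.log_le_log two_pos hND
    have h2 := Real.log_two_gt_d9
    linarith
  have hexp : Real.exp (-L) = δ / N := by
    rw [Real.exp_neg, hL, Real.exp_log (by positivity), inv_div]
  rw [Real.sqrt_div (Nat.cast_nonneg n), ← add_div, div_mul_eq_mul_div, div_le_iff₀ hb,
    add_mul] at h
  have ha1 : 1 ≤ √(n : ℝ) := Real.one_le_sqrt.2 hn'
  have p1 : 0 ≤ n * ρ * L := by positivity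
  have p2 : 0 ≤ √n * L := by positivity
  have hs : 0 < √N₀ := Real.sqrt_pos.2 (by linarith)
  -- A small `c` forces `N` to be large: `1/2 ≤ L ≤ √n L ≤ c √N ≤ √N / (2 √N₀)`.
  have hsN : √N₀ ≤ √N := by
    have h1 : 1 / 2 ≤ c * √N := by nlinarith
    have h2 : c * √N ≤ 1 / (2 * √N₀) * √N := mul_le_mul_of_nonneg_right hc hb.le
    rw [div_mul_eq_mul_div, one_mul] at h2
    have h3 := h1.trans h2
    rw [div_le_div_iff₀ two_pos (by positivity)] at h3
    linarith
  have hNN : N₀ ≤ N := (Real.sqrt_le_sqrt_iff hN0.le).1 hsN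
  have hL1 : 1 ≤ L := by
    rw [hL, Real.le_log_iff_exp_le (by positivity)]
    have h1 : (N : ℝ) ≤ N / δ := by rw [le_div_iff₀ hδ]; nlinarith
    linarith [Real.exp_one_lt_three]
  refine ⟨hNN, hL1, ?_, hexp, by linarith, by linarith⟩
  -- The seventh power enters only through `L⁴ ≤ N`.
  refine Real.le_sqrt_of_sq_le ?_
  rw [← pow_mul]
  exact (pow_le_pow_right₀ hL1 (by norm_num)).trans hlog

theorem five_pow_le_exp (n : ℕ) : (5 : ℝ) ^ n ≤ Real.exp (2 * n) := by
  rw [mul_comm, Real.exp_nat_mul]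
  refine pow_le_pow_left₀ (by norm_num) ?_ n
  have h : Real.exp 2 = Real.exp 1 ^ 2 := by rw [← Real.exp_nat_mul]; norm_num
  have h2 : (2.5 : ℝ) ≤ Real.exp 1 := by linarith [Real.exp_one_gt_d9]
  rw [h]
  calc (5 : ℝ) ≤ 2.5 ^ 2 := by norm_num
    _ ≤ _ := by gcongr

theorem nullLaw_specNorm_gt_le_half {α : ℝ} (hα : 0 < α) :
    ∃ c > (0 : ℝ), ∀ (N n : ℕ) (ρ δ : ℝ), 1 ≤ n → n ≤ N → 0 < ρ → ρ ≤ 1 → 0 < δ → δ < 1 / 2 →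
      Real.log (N / δ) ^ 7 ≤ N →
      (n * ρ / √N + √(n / N)) * Real.log (N / δ) ≤ c →
      (nullLaw N n).real {Y | specNorm (spectralMatrix Y) > 34 * (α / (N * ρ))} ≤ δ / 2 := by
  set M := expMomentConst with hM
  have hM0 : 0 < M := Real.exp_pos _
  set K := gaussianSqConst with hK
  have hK0 : 0 ≤ K := gaussianSqConst_nonneg
  -- The three summands give `δ/N ≤ δ/8`, `M δ/N ≤ δ/8`, and a truncation bias below `s/4`.
  set N₀ : ℝ := 8 + 8 * M + 32 * (2 * M + 3) / α with hN₀
  have hN₀p : 0 < 32 * (2 * M + 3) / α := by positivity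
  have hN₀8 : 8 + 8 * M + 32 * (2 * M + 3) / α ≤ N₀ := le_rfl
  have hN₀3 : 3 ≤ N₀ := by linarith
  have hsN₀ : 0 < √N₀ := Real.sqrt_pos.2 (by linarith)
  refine ⟨min (min 1 (1 / (2 * √N₀))) (min (α / 3072) (α ^ 2 / (24576 * (K + 1)))),
    by positivity, ?_⟩
  intro N n ρ δ hn hnN hρ hρ1 hδ hδ' hlog h
  set c := min (min 1 (1 / (2 * √N₀))) (min (α / 3072) (α ^ 2 / (24576 * (K + 1)))) with hc
  have hc0 : 0 < c := by rw [hc]; positivity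
  have hc1 : c ≤ 1 := (min_le_left _ _).trans (min_le_left _ _)
  have hc2 : c ≤ 1 / (2 * √N₀) := (min_le_left _ _).trans (min_le_right _ _)
  have hc3 : c ≤ α / 3072 := (min_le_right _ _).trans (min_le_left _ _)
  have hc4 : c ≤ α ^ 2 / (24576 * (K + 1)) := (min_le_right _ _).trans (min_le_right _ _)
  obtain ⟨hNN, hL1, hLb, hexp, hp, hq⟩ := scaling_bounds hn hnN hρ hδ hδ' hlog h hN₀3 hc2
  set L := Real.log (N / δ) with hL
  set a := √(n : ℝ) with ha
  set b := √(N : ℝ) with hb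
  have hn' : (1 : ℝ) ≤ n := by exact_mod_cast hn
  have hNn : (n : ℝ) ≤ N := by exact_mod_cast hnN
  have hN0 : (0 : ℝ) < N := by linarith
  have ha2 : a ^ 2 = n := Real.sq_sqrt (by linarith)
  have hb2 : b ^ 2 = N := Real.sq_sqrt hN0.le
  have ha1 : 1 ≤ a := Real.one_le_sqrt.2 hn'
  have hab : a ≤ b := Real.sqrt_le_sqrt hNn
  have hbN : b ≤ N := hb2 ▸ le_self_pow₀ (ha1.trans hab) two_ne_zero
  have hLb1 : L ≤ b := (le_self_pow₀ hL1 two_ne_zero).trans hLb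
  have hs : 0 < α * N / ρ := by positivity
  -- The factor `32` makes the bias factor `e^{-B/(16√n)}` equal to `(δ/N)²`, and the row tail
  -- smaller still. In `t`, the `2n` absorbs the net size `5 ^ n ≤ e^{2n}` and the `L` leaves `δ/N`.
  have key := nullLaw_specNorm_gt_le (N := N) hn (hn.trans hnN) (B := 32 * a * L)
    (s := α * N / ρ) (t := 2 * n + L) (by positivity) hs (by positivity) ?_ ?_ ?_
  · have e1 : 34 * (α * N / ρ / (N : ℝ) ^ 2) = 34 * (α / (N * ρ)) := by field_simp
    rw [e1] at key
    refine key.trans ?_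
    have e2 : Real.exp (-(32 * a * L / (4 * a))) ≤ δ / N * (δ / N) := by
      rw [← hexp, ← Real.exp_add, Real.exp_le_exp]
      have : 32 * a * L / (4 * a) = 8 * L := by field_simp; norm_num
      rw [this]; linarith
    have e3 : (5 : ℝ) ^ n * Real.exp (-(2 * n + L)) ≤ δ / N := by
      have h5 := five_pow_le_exp n
      calc _ ≤ Real.exp (2 * n) * Real.exp (-(2 * n + L)) := by gcongr
        _ = δ / N := by rw [← Real.exp_add, ← hexp]; congr 1; ring
    have hdN : δ / N ≤ δ / 8 := by
      refine div_le_div_of_nonneg_left hδ.le (by norm_num) (by linarith)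
    have hdM : M * (δ / N) ≤ 1 / 8 * δ := by
      rw [mul_div_assoc', div_le_iff₀ hN0]
      have : 8 * M ≤ N := by linarith
      linarith [mul_le_mul_of_nonneg_right this hδ.le]
    have g1 : N * (2 * M * Real.exp (-(32 * a * L / (4 * a)))) ≤ δ / 4 := by
      calc _ ≤ N * (2 * M * (δ / N * (δ / N))) := by gcongr
        _ = 2 * δ * (M * (δ / N)) := by field_simp
        _ ≤ 2 * δ * (1 / 8 * δ) := by gcongr
        _ = δ / 4 * δ := by ring
        _ ≤ δ / 4 := mul_le_of_le_one_right (by positivity) (by linarith)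
    have g2 : (5 : ℝ) ^ n * (2 * Real.exp (-(2 * n + L))) ≤ δ / 4 := by
      calc _ = 2 * ((5 : ℝ) ^ n * Real.exp (-(2 * n + L))) := by ring
        _ ≤ 2 * (δ / 8) := by gcongr; exact e3.trans hdN
        _ = δ / 4 := by ring
    linarith
  · have e1 : Real.exp (-(32 * a * L / (16 * a))) ≤ 1 / N * (1 / N) := by
      have h1 : Real.exp (-(32 * a * L / (16 * a))) = δ / N * (δ / N) := by
        rw [← hexp, ← Real.exp_add]; congr 1; field_simp; norm_num
      rw [h1]
      have : δ / N ≤ 1 / N := by gcongr; linarith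
      gcongr
    have e2 : α * N ≤ α * N / ρ := by
      rw [le_div_iff₀ hρ]; exact mul_le_of_le_one_right (by positivity) hρ1
    have e3 : 32 * (2 * M + 3) ≤ α * N := by
      have : 32 * (2 * M + 3) / α ≤ N := by linarith
      rwa [div_le_iff₀' hα] at this
    calc N * (Real.exp (-(32 * a * L / (16 * a))) * (8 * a) * (2 * M + 3))
        ≤ N * (1 / N * (1 / N) * (8 * N) * (2 * M + 3)) := by
          gcongr; exact hab.trans hbN
      _ = 8 * (2 * M + 3) := by field_simp
      _ ≤ _ := by linarith
  · rw [le_div_iff₀ hρ, ← ha2, ← hb2]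
    rw [← ha2] at hp
    have q1 : a ^ 2 * ρ * L * a ≤ c * b * b := by gcongr
    have q2 : a * L * (L * ρ) ≤ c * b * b := by
      exact mul_le_mul hq ((mul_le_of_le_one_right (by linarith) hρ1).trans hLb1)
        (by positivity) (by positivity)
    have q3 : c * (b * b) ≤ α / 3072 * (b * b) := by gcongr
    have e : 8 * (32 * a * L) * (2 * a ^ 2 + L) * ρ
        = 256 * (2 * (a ^ 2 * ρ * L * a) + a * L * (L * ρ)) := by ring
    have hα' : 0 ≤ α * (b * b) := by positivity
    rw [e, sq b]
    linarith
  · rw [div_pow, le_div_iff₀ (by positivity), ← ha2, ← hb2]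
    rw [← ha2] at hp
    have hb0 : 0 < b := by linarith
    have q1 : (a ^ 2 * ρ * L) ^ 2 ≤ c * b ^ 2 := by
      calc _ ≤ (c * b) ^ 2 := by gcongr
        _ = c * c * b ^ 2 := by ring
        _ ≤ 1 * c * b ^ 2 := by gcongr
        _ = _ := by ring
    have q2 : (a ^ 2 * ρ * L) * (L ^ 2 * ρ) ≤ c * b ^ 2 := by
      calc _ ≤ (c * b) * (b * 1) := by gcongr
        _ = _ := by ring
    have q3 : 24576 * K * c ≤ α ^ 2 := by
      rw [le_div_iff₀ (by positivity)] at hc4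
      linarith
    calc 8 * K * b ^ 2 * (32 * a * L) ^ 2 * (2 * a ^ 2 + L) * ρ ^ 2
        = 8192 * K * b ^ 2 * (2 * (a ^ 2 * ρ * L) ^ 2 + (a ^ 2 * ρ * L) * (L ^ 2 * ρ)) := by ring
      _ ≤ 8192 * K * b ^ 2 * (2 * (c * b ^ 2) + c * b ^ 2) := by gcongr
      _ = (24576 * K * c) * b ^ 4 := by ring
      _ ≤ α ^ 2 * b ^ 4 := by gcongr
      _ = (α * b ^ 2) ^ 2 := by ring

/-! ### The planted law: support size, column noise and the planted direction -/

/-- On the atoms `(Nρx²)²` is the indicator of `x ≠ 0`, a Bernoulli variable of mean `ρ`, and `1 + ρ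
(e^l - 1) ≤ 1 + ρ (l + l²)` for `|l| ≤ 1`. -/
theorem integral_exp_brEntry_le {N : ℕ} (hN : 1 ≤ N) {ρ l : ℝ} (h0 : 0 < ρ) (h1 : ρ ≤ 1)
    (hl : |l| ≤ 1) :
    Integrable (fun x => Real.exp (l * (N * ρ * x ^ 2) ^ 2)) (brEntry N ρ) ∧
      ∫ x, Real.exp (l * (N * ρ * x ^ 2) ^ 2) ∂brEntry N ρ ≤ Real.exp (ρ * (l + l ^ 2)) := by
  have hN' : (0 : ℝ) < N := by exact_mod_cast hN
  have hs : √(N * ρ) ^ 2 = N * ρ := Real.sq_sqrt (by positivity)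
  set f : ℝ → ℝ := fun x => Real.exp (l * (N * ρ * x ^ 2) ^ 2) with hf
  have hd : ∀ (x : ℝ) (r : NNReal), Integrable f (r • Measure.dirac x) := fun x r =>
    (integrable_dirac (by simp)).smul_measure_nnreal
  have f0 : f 0 = 1 := by simp [hf]
  have f1 : f (1 / √(N * ρ)) = Real.exp l := by
    simp only [hf, div_pow, hs]; congr 1; field_simp
  have f2 : f (-1 / √(N * ρ)) = Real.exp l := by
    simp only [hf, div_pow, hs]; congr 1; field_simp
  refine ⟨((hd _ _).add_measure (hd _ _)).add_measure (hd _ _), ?_⟩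
  rw [brEntry, integral_add_measure ((hd _ _).add_measure (hd _ _)) (hd _ _),
    integral_add_measure (hd _ _) (hd _ _)]
  simp only [integral_smul_nnreal_measure, integral_dirac, f0, f1, f2, NNReal.smul_def,
    smul_eq_mul]
  rw [Real.coe_toNNReal _ (by linarith), Real.coe_toNNReal _ (by linarith)]
  have h2 := (abs_le.1 (Real.abs_exp_sub_one_sub_id_le hl)).2
  have h3 := Real.add_one_le_exp (ρ * (l + l ^ 2))
  nlinarith

theorem brVector_isProbabilityMeasure (N : ℕ) {ρ : ℝ} (h0 : 0 < ρ) (h1 : ρ ≤ 1) :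
    IsProbabilityMeasure (brVector N ρ) := by
  have := brEntry_isProbabilityMeasure N h0 h1
  unfold brVector
  infer_instance

/-- The number of nonzero entries of `v`, written as a polynomial in the entries. -/
noncomputable def suppSize {N : ℕ} (ρ : ℝ) (v : Fin N → ℝ) : ℝ := ∑ i, (N * ρ * v i ^ 2) ^ 2

theorem measurable_suppSize {N : ℕ} (ρ : ℝ) : Measurable (suppSize (N := N) ρ) :=
  Finset.measurable_sum _ fun i _ =>
    (((measurable_pi_apply i).pow_const 2).const_mul _).pow_const 2

theorem brVector_abs_suppSize_sub_ge_le {N : ℕ} (hN : 1 ≤ N) {ρ ε : ℝ} (h0 : 0 < ρ) (h1 : ρ ≤ 1)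
    (hε : 0 < ε) (hε1 : ε ≤ 1) :
    (brVector N ρ).real {v | ε * (N * ρ) ≤ |suppSize ρ v - N * ρ|}
      ≤ 2 * Real.exp (-(N * ρ * ε ^ 2 / 4)) := by
  have := brEntry_isProbabilityMeasure N h0 h1
  have := brVector_isProbabilityMeasure N h0 h1
  have side : ∀ e : ℝ, |e| = 1 →
      (brVector N ρ).real {v | ε * (N * ρ) ≤ e * (suppSize ρ v - N * ρ)}
        ≤ Real.exp (-(N * ρ * ε ^ 2 / 4)) := by
    intro e he
    have he2 : e ^ 2 = 1 := by rw [← sq_abs, he, one_pow]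
    have hl : |e * (ε / 2)| ≤ 1 := by
      rw [abs_mul, he, one_mul, abs_of_pos (by positivity)]; linarith
    have key := integral_exp_brEntry_le hN h0 h1 hl
    -- The parameter `l = ±ε/2` minimizes `Nρ (l² - ε |l|)`, with value `-Nρε²/4`.
    have hc := measureReal_pi_sum_ge_le (μ := fun _ : Fin N => brEntry N ρ)
      (f := fun _ x => e * (ε / 2) * (N * ρ * x ^ 2) ^ 2)
      (s := ε / 2 * (ε * (N * ρ)) + e * (ε / 2) * (N * ρ)) (fun _ => key.1) (fun _ => key.2)
    refine (measureReal_mono fun v hv => ?_).trans (hc.trans (Real.exp_le_exp.2 (le_of_eq ?_)))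
    · simp only [Set.mem_ofPred_eq] at hv ⊢
      rw [← Finset.mul_sum]
      unfold suppSize at hv
      nlinarith [mul_le_mul_of_nonneg_left hv (by linarith : 0 ≤ ε / 2)]
    · simp only [Finset.sum_const, Finset.card_univ, Fintype.card_fin, nsmul_eq_mul]
      rw [mul_pow, he2]
      ring
  refine (measureReal_mono (s₂ := {v | ε * (N * ρ) ≤ 1 * (suppSize ρ v - N * ρ)} ∪
    {v | ε * (N * ρ) ≤ -1 * (suppSize ρ v - N * ρ)}) fun v hv => ?_).trans
    ((measureReal_union_le _ _).trans ?_)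
  · simp only [Set.mem_ofPred_eq, Set.mem_union, one_mul, neg_mul] at hv ⊢
    exact le_abs.1 hv
  · linarith [side 1 (by simp), side (-1) (by simp)]

/-- The centred contribution of the Gaussian columns to the quadratic form at the planted
direction, multiplied by `N² ρ`. -/
noncomputable def columnNoise {N n : ℕ} (ρ : ℝ) (v : Fin N → ℝ) (G : Matrix (Fin N) (Fin n) ℝ) :
    ℝ :=
  ∑ i, N * ρ * v i ^ 2 * ∑ j : Fin n, (if (j : ℕ) = 0 then 0 else (N * G i j ^ 2 - 1))

theorem measurable_columnNoise {N n : ℕ} (ρ : ℝ) :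
    Measurable fun p : (Fin N → ℝ) × Matrix (Fin N) (Fin n) ℝ => columnNoise ρ p.1 p.2 := by
  refine Finset.measurable_sum _ fun i _ => Measurable.mul ?_ ?_
  · exact (((measurable_pi_apply i).comp measurable_fst).pow_const 2).const_mul _
  · refine Finset.measurable_sum _ fun j _ => ?_
    split_ifs
    · exact measurable_const
    · have h : Measurable fun p : (Fin N → ℝ) × Matrix (Fin N) (Fin n) ℝ => p.2 i j :=
        (measurable_pi_apply j).comp ((measurable_pi_apply i).comp measurable_snd)
      exact ((h.pow_const 2).const_mul _).sub_const _

/-- For fixed `v` the noise is a weighted sum of independent centred squared Gaussians. The squared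
weights of one column sum to `suppSize ρ v`, which therefore acts as the variance proxy. -/
theorem gaussianMatrix_abs_columnNoise_ge_le {N n : ℕ} (hN : 1 ≤ N) {ρ θ s : ℝ}
    (hρ : 0 ≤ ρ) (hθ : 0 ≤ θ) {v : Fin N → ℝ} (hv : ∀ i, θ * (N * ρ * v i ^ 2) ≤ 1 / 4) :
    (gaussianMatrix N n).real {G | s ≤ |columnNoise ρ v G|}
      ≤ 2 * Real.exp (θ ^ 2 * n * gaussianSqConst * suppSize ρ v - θ * s) := by
  have hN' : (0 : ℝ) < N := by exact_mod_cast hN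
  have hmeas : Measurable (fun G : Matrix (Fin N) (Fin n) ℝ => columnNoise ρ v G) :=
    (measurable_columnNoise ρ).comp (measurable_const.prodMk measurable_id)
  have side : ∀ e : ℝ, |e| = 1 →
      (gaussianMatrix N n).real {G | s ≤ e * columnNoise ρ v G}
        ≤ Real.exp (θ ^ 2 * n * gaussianSqConst * suppSize ρ v - θ * s) := by
    intro e he
    have he2 : e ^ 2 = 1 := by rw [← sq_abs, he, one_pow]
    rw [← map_scaleRows, map_measureReal_apply measurable_scaleRows
      (measurableSet_le measurable_const (hmeas.const_mul e))]
    set w : Fin N → Fin n → ℝ := fun i j =>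
      if (j : ℕ) = 0 then 0 else e * θ * (N * ρ * v i ^ 2) with hw
    have hwb : ∀ i j, |w i j| ≤ 1 / 4 := by
      intro i j
      simp only [hw]
      split_ifs
      · simp
      · rw [abs_mul, abs_mul, he, one_mul, abs_of_nonneg hθ, abs_of_nonneg (by positivity)]
        exact hv i
    have key := fun i => integral_exp_sum_sq_sub_one_le (hwb i)
    have hle : ∀ i, ∑ j, w i j ^ 2 * gaussianSqConst
        ≤ θ ^ 2 * n * gaussianSqConst * (N * ρ * v i ^ 2) ^ 2 := by
      intro i
      refine (Finset.sum_le_card_nsmul Finset.univ _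
        (θ ^ 2 * (N * ρ * v i ^ 2) ^ 2 * gaussianSqConst) fun j _ => ?_).trans (le_of_eq ?_)
      · refine mul_le_mul_of_nonneg_right ?_ gaussianSqConst_nonneg
        simp only [hw]
        split_ifs
        · simp only [ne_eq, OfNat.ofNat_ne_zero, not_false_eq_true, zero_pow]; positivity
        · rw [mul_pow, mul_pow, he2, one_mul]
      · simp only [Finset.card_univ, Fintype.card_fin, nsmul_eq_mul]; ring
    have hc := measureReal_pi_sum_ge_le (μ := fun _ : Fin N => stdGauss n)
      (f := fun i x => ∑ j, w i j * (x j ^ 2 - 1)) (s := θ * s)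
      (fun i => (key i).1) (fun i => (key i).2)
    refine (measureReal_mono fun X hX => ?_).trans (hc.trans (Real.exp_le_exp.2 ?_))
    · simp only [Set.mem_preimage, Set.mem_ofPred_eq] at hX ⊢
      have : ∑ i, ∑ j, w i j * (X i j ^ 2 - 1) = θ * (e * columnNoise ρ v (scaleRows X)) := by
        rw [columnNoise, Finset.mul_sum, Finset.mul_sum]
        refine Finset.sum_congr rfl fun i _ => ?_
        rw [Finset.mul_sum, Finset.mul_sum, Finset.mul_sum]
        refine Finset.sum_congr rfl fun j _ => ?_
        simp only [hw, scaleRows, Matrix.of_apply, div_pow, Real.sq_sqrt hN'.le]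
        split_ifs
        · simp
        · rw [mul_div_cancel₀ _ hN'.ne']; ring
      rw [this]
      exact mul_le_mul_of_nonneg_left hX hθ
    · rw [suppSize, Finset.mul_sum]
      exact sub_le_sub_right (Finset.sum_le_sum fun i _ => hle i) _
  refine (measureReal_mono (s₂ := {G | s ≤ 1 * columnNoise ρ v G} ∪
    {G | s ≤ -1 * columnNoise ρ v G}) fun v hv => ?_).trans
    ((measureReal_union_le _ _).trans ?_)
  · simp only [Set.mem_ofPred_eq, Set.mem_union, one_mul, neg_mul] at hv ⊢
    exact le_abs.1 hv
  · linarith [side 1 (by simp), side (-1) (by simp)]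

/-- The quadratic form is evaluated at row `0` of `Q`, a unit vector that the observation maps to
`v`. Right multiplication by `Q` keeps row norms, so `Q` disappears. The inequality is
deterministic, with no assumption on the values of `v`. -/
theorem specNorm_plantedObservation_ge {N n : ℕ} (hN : 1 ≤ N) (hn : 1 ≤ n) {ρ : ℝ} (hρ : 0 < ρ)
    (ω : (Fin N → ℝ) × Matrix (Fin N) (Fin n) ℝ × Matrix.orthogonalGroup (Fin n) ℝ) :
    |suppSize ρ ω.1 / (N * ρ) - 3 * ρ + columnNoise ρ ω.1 ω.2.1 / N| / (N * ρ)
      ≤ specNorm (spectralMatrix (plantedObservation ω)) := by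
  obtain ⟨v, G, Q⟩ := ω
  have hN' : (0 : ℝ) < N := by exact_mod_cast hN
  set z : Fin n := ⟨0, hn⟩ with hz
  set A := plantFirstColumn v G with hA
  have hQ : (Q : Matrix (Fin n) (Fin n) ℝ) * (Q : Matrix (Fin n) (Fin n) ℝ).transpose = 1 :=
    (Matrix.mem_orthogonalGroup_iff (Fin n) ℝ).1 Q.2
  have hu : ∑ j, (Q : Matrix (Fin n) (Fin n) ℝ) z j ^ 2 = 1 := by
    have := congrFun (congrFun hQ z) z
    simpa [Matrix.mul_apply, sq] using this
  have hrow : ∀ i, ∑ j, (A * (Q : Matrix (Fin n) (Fin n) ℝ)) i j ^ 2 = ∑ j, A i j ^ 2 := by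
    intro i
    have h : (A * (Q : Matrix (Fin n) (Fin n) ℝ)) * (A * (Q : Matrix (Fin n) (Fin n) ℝ)).transpose
        = A * A.transpose := by
      rw [Matrix.transpose_mul, Matrix.mul_assoc, ← Matrix.mul_assoc _ _ A.transpose, hQ,
        Matrix.one_mul]
    have := congrFun (congrFun h i) i
    rw [Matrix.mul_apply, Matrix.mul_apply] at this
    simpa only [Matrix.transpose_apply, ← sq] using this
  have hlin : ∀ i, ∑ j, (Q : Matrix (Fin n) (Fin n) ℝ) z j
      * (A * (Q : Matrix (Fin n) (Fin n) ℝ)) i j = v i := by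
    intro i
    have h : (A * (Q : Matrix (Fin n) (Fin n) ℝ)) * (Q : Matrix (Fin n) (Fin n) ℝ).transpose
        = A := by
      rw [Matrix.mul_assoc, hQ, Matrix.mul_one]
    have := congrFun (congrFun h i) z
    rw [Matrix.mul_apply] at this
    simp only [Matrix.transpose_apply] at this
    simp_rw [mul_comm ((Q : Matrix (Fin n) (Fin n) ℝ) z _)]
    rw [this, hA]
    simp [plantFirstColumn, hz]
  have hcol : ∀ i, (∑ j, A i j ^ 2) - ((n : ℝ) - 1) / N
      = v i ^ 2 + (∑ j : Fin n, (if (j : ℕ) = 0 then 0 else (N * G i j ^ 2 - 1))) / N := by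
    intro i
    -- Every column carries `1/N`, `n/N` in all. The `-1/N` in the planted column lowers this to the
    -- subtracted `(n - 1)/N`.
    have hsplit : ∀ j : Fin n, A i j ^ 2 = (if j = z then v i ^ 2 - 1 / N else 0)
        + (if (j : ℕ) = 0 then 0 else (N * G i j ^ 2 - 1)) / N + 1 / N := by
      intro j
      have hj : j = z ↔ (j : ℕ) = 0 := by rw [hz, Fin.ext_iff]
      simp only [hA, plantFirstColumn, Matrix.of_apply, hj]
      split_ifs
      · ring
      · field_simp; ring
    simp_rw [hsplit]
    rw [Finset.sum_add_distrib, Finset.sum_add_distrib, Finset.sum_ite_eq', ← Finset.sum_div]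
    simp
    ring
  have h := abs_dotProduct_mulVec_le_specNorm (spectralMatrix (plantedObservation (v, G, Q))) hu
  rw [dotProduct_spectralMatrix_mulVec, hu] at h
  simp only [plantedObservation, ← hA, hrow, hlin, hcol] at h
  refine le_trans (le_of_eq ?_) h
  rw [← abs_of_pos (by positivity : 0 < N * ρ), ← abs_div, abs_of_pos (by positivity : 0 < N * ρ)]
  congr 1
  rw [suppSize, columnNoise]
  simp only [add_mul, Finset.sum_add_distrib, Finset.sum_div, add_div, sub_div]
  have e1 : ∀ i, (N * ρ * v i ^ 2) ^ 2 / (N * ρ) / (N * ρ) = v i ^ 2 * v i ^ 2 := by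
    intro i; field_simp
  have e2 : ∀ (i : Fin N) (x : ℝ), N * ρ * v i ^ 2 * x / N / (N * ρ) = x / N * v i ^ 2 := by
    intro i x; field_simp
  have e3 : 3 * ρ / (N * ρ) = 3 / N * 1 := by field_simp
  simp only [e1, e2, e3, Finset.sum_div, Finset.sum_mul]
  ring

theorem measureReal_prod_le_of_section {α β : Type*} [MeasurableSpace α] [MeasurableSpace β]
    {μ : Measure α} {ν : Measure β} [IsProbabilityMeasure μ] [IsProbabilityMeasure ν]
    {s : Set (α × β)} (hs : MeasurableSet s) {p : ℝ} (hp : 0 ≤ p)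
    (h : ∀ a, ν.real (Prod.mk a ⁻¹' s) ≤ p) : (μ.prod ν).real s ≤ p := by
  refine ENNReal.toReal_le_of_le_ofReal hp ?_
  rw [Measure.prod_apply hs]
  calc ∫⁻ a, ν (Prod.mk a ⁻¹' s) ∂μ ≤ ∫⁻ _, ENNReal.ofReal p ∂μ := by
        refine lintegral_mono fun a => ?_
        rw [← ofReal_measureReal]
        exact ENNReal.ofReal_le_ofReal (h a)
    _ = ENNReal.ofReal p := by simp

/-- Since `|1 - 3ρ| ≥ 3c`, two errors below `c` leave at least `c`, more than the `c/4` required. -/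
theorem abs_ge_of_close {ρ x y c : ℝ} (hc : 0 < c) (hρ : c ≤ |ρ - 1 / 3|)
    (hx : |x - 1| < c) (hy : |y| < c) : c / 4 ≤ |x - 3 * ρ + y| := by
  rw [abs_lt] at hx hy
  rcases le_abs.1 hρ with h | h
  · rw [le_abs]; right; linarith
  · rw [le_abs]; left; linarith

theorem plantedLaw_specNorm_lt_le {N n : ℕ} (hN : 1 ≤ N) (hn : 1 ≤ n) {ρ c θ : ℝ} (hρ : 0 < ρ)
    (hρ1 : ρ ≤ 1) (hc : 0 < c) (hc1 : c ≤ 1) (hθ : 0 ≤ θ) (hθN : θ * (2 * √N) ≤ 1 / 4)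
    (hgap : c ≤ |ρ - 1 / 3|) :
    (plantedLaw N n ρ).real {Y | specNorm (spectralMatrix Y) < c / (4 * N * ρ)}
      ≤ 2 * Real.exp (-(N * ρ * c ^ 2 / 4))
        + 2 * Real.exp (θ ^ 2 * n * gaussianSqConst * (2 * N) - θ * (c * N)) := by
  have hN' : (0 : ℝ) < N := by exact_mod_cast hN
  have := brVector_isProbabilityMeasure N hρ hρ1
  rw [plantedLaw, map_measureReal_apply measurable_plantedObservation
    (measurableSet_lt measurable_specNorm_spectralMatrix measurable_const)]
  set bad₁ : Set (Fin N → ℝ) := {v | c * (N * ρ) ≤ |suppSize ρ v - N * ρ|} with hbad₁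
  set bad₂ : Set ((Fin N → ℝ) × Matrix (Fin N) (Fin n) ℝ) :=
    {p | suppSize ρ p.1 ≤ 2 * N ∧ c * N ≤ |columnNoise ρ p.1 p.2|} with hbad₂
  have hm₁ : MeasurableSet bad₁ :=
    measurableSet_le measurable_const ((measurable_suppSize ρ).sub_const _).norm
  have hm₂ : MeasurableSet bad₂ :=
    (measurableSet_le ((measurable_suppSize ρ).comp measurable_fst) measurable_const).inter
      (measurableSet_le measurable_const (measurable_columnNoise ρ).norm)
  have hmap : Measurable fun ω :
      (Fin N → ℝ) × Matrix (Fin N) (Fin n) ℝ × Matrix.orthogonalGroup (Fin n) ℝ =>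
      (ω.1, ω.2.1) :=
    measurable_fst.prodMk (measurable_fst.comp measurable_snd)
  have hsub : plantedObservation ⁻¹'
      {Y : Matrix (Fin N) (Fin n) ℝ | specNorm (spectralMatrix Y) < c / (4 * N * ρ)}
      ⊆ Prod.fst ⁻¹' bad₁ ∪ (fun ω => (ω.1, ω.2.1)) ⁻¹' bad₂ := by
    intro ω hω
    by_contra hcon
    simp only [Set.mem_union, Set.mem_preimage, hbad₁, hbad₂, Set.mem_ofPred_eq, not_or, not_and,
      not_le] at hcon
    obtain ⟨g1, g2⟩ := hcon
    have h1 : |suppSize ρ ω.1 / (N * ρ) - 1| < c := by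
      have e : suppSize ρ ω.1 / (N * ρ) - 1 = (suppSize ρ ω.1 - N * ρ) / (N * ρ) := by
        field_simp
      rw [e, abs_div, abs_of_pos (by positivity : 0 < N * ρ), div_lt_iff₀ (by positivity)]
      exact g1
    have h2 : suppSize ρ ω.1 ≤ 2 * N := by
      have := (abs_lt.1 g1).2
      have h3 : N * ρ ≤ N := mul_le_of_le_one_right hN'.le hρ1
      have h4 : c * (N * ρ) ≤ N * ρ := mul_le_of_le_one_left (by positivity) hc1
      linarith
    have h3 : |columnNoise ρ ω.1 ω.2.1 / N| < c := by
      rw [abs_div, abs_of_pos hN', div_lt_iff₀ hN']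
      exact g2 h2
    have h4 := abs_ge_of_close hc hgap h1 h3
    have h5 := specNorm_plantedObservation_ge hN hn hρ ω
    have h6 : c / (4 * N * ρ)
        ≤ |suppSize ρ ω.1 / (N * ρ) - 3 * ρ + columnNoise ρ ω.1 ω.2.1 / N| / (N * ρ) := by
      rw [show c / (4 * N * ρ) = c / 4 / (N * ρ) by field_simp]
      gcongr
    exact absurd hω (not_lt.2 (h6.trans h5))
  refine (measureReal_mono hsub).trans ((measureReal_union_le _ _).trans (add_le_add ?_ ?_))
  · refine le_trans (le_of_eq ?_) (brVector_abs_suppSize_sub_ge_le hN hρ hρ1 hc hc1)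
    exact measurePreserving_fst.measureReal_preimage hm₁.nullMeasurableSet
  · refine measureReal_prod_le_of_section (hmap hm₂) (by positivity) fun v => ?_
    have hsec : Prod.mk v ⁻¹' ((fun ω : (Fin N → ℝ) × Matrix (Fin N) (Fin n) ℝ ×
        Matrix.orthogonalGroup (Fin n) ℝ => (ω.1, ω.2.1)) ⁻¹' bad₂)
        = Prod.fst ⁻¹' {G | (v, G) ∈ bad₂} := rfl
    have hmv : MeasurableSet {G | (v, G) ∈ bad₂} := measurable_prodMk_left hm₂
    rw [hsec, measurePreserving_fst.measureReal_preimage hmv.nullMeasurableSet]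
    -- The bound on the support size is part of `bad₂`, so each section is either empty or has
    -- `Nρv_i² ≤ 2√N` for all `i`. This crude bound replaces the almost sure one `Nρv_i² ≤ 1`.
    by_cases hv : suppSize ρ v ≤ 2 * N
    · have hvi : ∀ i, θ * (N * ρ * v i ^ 2) ≤ 1 / 4 := by
        intro i
        refine le_trans (mul_le_mul_of_nonneg_left ?_ hθ) hθN
        have h1 : (N * ρ * v i ^ 2) ^ 2 ≤ suppSize ρ v :=
          Finset.single_le_sum (f := fun i => (N * ρ * v i ^ 2) ^ 2)
            (fun i _ => sq_nonneg _) (Finset.mem_univ i)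
        refine abs_le_of_sq_le_sq' ?_ (by positivity) |>.2
        rw [mul_pow 2, Real.sq_sqrt hN'.le]
        linarith
      refine (measureReal_mono fun G hG => hG.2).trans
        ((gaussianMatrix_abs_columnNoise_ge_le hN hρ.le hθ hvi).trans ?_)
      have := gaussianSqConst_nonneg
      gcongr
    · have : {G : Matrix (Fin N) (Fin n) ℝ | (v, G) ∈ bad₂} = ∅ := by
        ext G; simp [hbad₂, hv]
      rw [this, measureReal_empty]
      positivity

theorem plantedLaw_specNorm_lt_le_half {c₁ : ℝ} (hc₁ : 0 < c₁) (hc₁' : c₁ ≤ 1) :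
    ∃ c > (0 : ℝ), ∀ (N n : ℕ) (ρ δ : ℝ), 1 ≤ n → n ≤ N → 0 < ρ → ρ ≤ 1 → 0 < δ → δ < 1 / 2 →
      16 / c₁ ^ 2 * Real.log (1 / δ) / N ≤ ρ → c₁ ≤ |ρ - 1 / 3| →
      Real.log (N / δ) ^ 7 ≤ N →
      (n * ρ / √N + √(n / N)) * Real.log (N / δ) ≤ c →
      (plantedLaw N n ρ).real {Y | specNorm (spectralMatrix Y) < c₁ / (4 * N * ρ)} ≤ δ / 2 := by
  set K := gaussianSqConst with hK
  have hK0 : 0 ≤ K := gaussianSqConst_nonneg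
  refine ⟨min (min 1 (1 / (2 * √8))) (min (c₁ / 16) (c₁ ^ 2 / (8 * (K + 1)))), by positivity, ?_⟩
  intro N n ρ δ hn hnN hρ hρ1 hδ hδ' hsparse hgap hlog h
  set c := min (min 1 (1 / (2 * √8))) (min (c₁ / 16) (c₁ ^ 2 / (8 * (K + 1)))) with hc
  have hc0 : 0 < c := by rw [hc]; positivity
  have hc1 : c ≤ 1 := (min_le_left _ _).trans (min_le_left _ _)
  have hc2 : c ≤ 1 / (2 * √8) := (min_le_left _ _).trans (min_le_right _ _)
  have hc3 : c ≤ c₁ / 16 := (min_le_right _ _).trans (min_le_left _ _)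
  have hc4 : c ≤ c₁ ^ 2 / (8 * (K + 1)) := (min_le_right _ _).trans (min_le_right _ _)
  obtain ⟨hNN, hL1, hLb, hexp, hp, hq⟩ :=
    scaling_bounds hn hnN hρ hδ hδ' hlog h (by norm_num) hc2
  set L := Real.log (N / δ) with hL
  set a := √(n : ℝ) with ha
  set b := √(N : ℝ) with hb
  have hn' : (1 : ℝ) ≤ n := by exact_mod_cast hn
  have hN0 : (0 : ℝ) < N := by linarith
  have hb0 : 0 < b := Real.sqrt_pos.2 hN0
  have ha2 : a ^ 2 = n := Real.sq_sqrt (by linarith)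
  have hb2 : b ^ 2 = N := Real.sq_sqrt hN0.le
  have ha1 : 1 ≤ a := Real.one_le_sqrt.2 hn'
  have hθ : 2 * L / (c₁ * N) * (2 * b) ≤ 1 / 4 := by
    rw [← hb2, show 2 * L / (c₁ * b ^ 2) * (2 * b) = 4 * L / (c₁ * b) by field_simp; ring,
      div_le_iff₀ (by positivity)]
    have h1 : L ≤ a * L := le_mul_of_one_le_left (by linarith) ha1
    have h2 : c * b ≤ c₁ / 16 * b := by gcongr
    linarith
  -- This `θ` makes the linear term `θ c₁ N` equal to `2L`, that is, a factor `(δ/N)²`, while the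
  -- scaling hypothesis keeps the quadratic term at most `1`.
  refine (plantedLaw_specNorm_lt_le (hn.trans hnN) hn hρ hρ1 hc₁ hc₁' (θ := 2 * L / (c₁ * N))
    (by positivity) hθ hgap).trans ?_
  -- The constant `16/c₁²` in the sparsity hypothesis turns the exponent into at least `4 log
  -- (1/δ)`.
  have g1 : Real.exp (-(N * ρ * c₁ ^ 2 / 4)) ≤ δ ^ 4 := by
    have h1 : δ ^ 4 = Real.exp (-(4 * Real.log (1 / δ))) := by
      rw [one_div, Real.log_inv, mul_neg, neg_neg, ← Real.log_rpow hδ,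
        Real.exp_log (by positivity)]
      norm_cast
    rw [h1, Real.exp_le_exp]
    rw [div_le_iff₀ hN0] at hsparse
    have h2 : 16 * Real.log (1 / δ) = 16 / c₁ ^ 2 * Real.log (1 / δ) * c₁ ^ 2 := by field_simp
    have h3 : 16 / c₁ ^ 2 * Real.log (1 / δ) * c₁ ^ 2 ≤ ρ * N * c₁ ^ 2 := by gcongr
    linarith
  have g2 : Real.exp ((2 * L / (c₁ * N)) ^ 2 * n * K * (2 * N) - 2 * L / (c₁ * N) * (c₁ * N))
      ≤ 3 * (δ / N * (δ / N)) := by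
    have h1 : (2 * L / (c₁ * N)) ^ 2 * n * K * (2 * N) ≤ 1 := by
      rw [← ha2, ← hb2, show (2 * L / (c₁ * b ^ 2)) ^ 2 * a ^ 2 * K * (2 * b ^ 2)
        = 8 * K * (a * L) ^ 2 / (c₁ ^ 2 * b ^ 2) by field_simp; ring,
        div_le_iff₀ (by positivity), one_mul]
      have h2 : (a * L) ^ 2 ≤ (c * b) ^ 2 := by gcongr
      rw [le_div_iff₀ (by positivity)] at hc4
      have h3 : c * c ≤ 1 * c := by gcongr
      calc 8 * K * (a * L) ^ 2 ≤ 8 * K * (c * b) ^ 2 := by gcongr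
        _ = 8 * K * (c * c) * b ^ 2 := by ring
        _ ≤ 8 * K * (1 * c) * b ^ 2 := by gcongr
        _ ≤ c₁ ^ 2 * b ^ 2 := by gcongr; linarith
    have h2 : 2 * L / (c₁ * N) * (c₁ * N) = L + L := by field_simp; ring
    rw [h2, sub_eq_add_neg, Real.exp_add, neg_add, Real.exp_add, hexp]
    gcongr
    exact (Real.exp_le_exp.2 h1).trans Real.exp_one_lt_three.le
  have hdN : δ / N ≤ δ / 8 := div_le_div_of_nonneg_left hδ.le (by norm_num) hNN
  have g3 : δ / N * (δ / N) ≤ δ / 8 * (δ / 8) := by gcongr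
  have g4 : δ * δ ≤ 1 / 2 * δ := by gcongr
  have g5 : δ ^ 4 ≤ 1 / 8 * δ := by
    calc δ ^ 4 = δ ^ 3 * δ := by ring
      _ ≤ (1 / 2) ^ 3 * δ := by gcongr
      _ = _ := by norm_num
  linarith

end PlantedVector


/-! ### Combination of the two error bounds -/

theorem theorem3p2 (c₁ : ℝ) (hc₁ : 0 < c₁) (hc₁' : c₁ < 0.1) :
    ∃ C₂ > (0 : ℝ), ∃ c₃ > (0 : ℝ),
      ∀ (N n : ℕ) (ρ δ : ℝ), 1 ≤ n → n ≤ N → 0 < ρ → ρ ≤ 1 → 0 < δ → δ < 1 / 2 →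
        C₂ * Real.log (1 / δ) / N ≤ ρ →
        c₁ ≤ |ρ - 1 / 3| →
        Real.log (N / δ) ^ 7 ≤ N →
        (n * ρ / √N + √(n / N)) * Real.log (N / δ) ≤ c₃ →
        (PlantedVector.plantedLaw N n ρ).real
            {Y | PlantedVector.specNorm (PlantedVector.spectralMatrix Y) < c₁ / (4 * N * ρ)}
          + (PlantedVector.nullLaw N n).real
            {Y | PlantedVector.specNorm (PlantedVector.spectralMatrix Y) > c₁ / (8 * N * ρ)}
          ≤ δ := by
  obtain ⟨c, hc, hnull⟩ :=
    -- Here `272 = 34 · 8`: the net factor `34` times the `8` of the null threshold.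
    PlantedVector.nullLaw_specNorm_gt_le_half (α := c₁ / 272) (by positivity)
  obtain ⟨c', hc', hplanted⟩ :=
    PlantedVector.plantedLaw_specNorm_lt_le_half hc₁ (by linarith)
  refine ⟨16 / c₁ ^ 2, by positivity, min c c', lt_min hc hc', ?_⟩
  intro N n ρ δ hn hnN hρ hρ1 hδ hδ' hsparse hgap hlog h
  have h1 := hnull N n ρ δ hn hnN hρ hρ1 hδ hδ' hlog (h.trans (min_le_left _ _))
  have h2 := hplanted N n ρ δ hn hnN hρ hρ1 hδ hδ' hsparse hgap hlog (h.trans (min_le_right _ _))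
  have e : 34 * (c₁ / 272 / (N * ρ)) = c₁ / (8 * N * ρ) := by
    have hN : (N : ℝ) ≠ 0 := by
      have : 1 ≤ N := hn.trans hnN
      positivity
    field_simp
    norm_num
  rw [e] at h1
  linarith
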